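/- Let $d\ge 0$ be an integer, let $$F(z_1,\dots,z_{d+1},t)=\frac{1}{1-z_1t-z_2t^2-\cdots-z_{d+1}t^{d+1}},$$ expanded as a power series in $t$, let $h(t)=1-t-t^2-\cdots-t^{d+1}$, and let $\rho>0$ be the smallest positive root of $h$ (which exists). For all $n\ge 0$ and $s_2,\dots,s_{d+1}\in\mathbb N$, the coefficient $[z_2^{s_2}\cdots z_{d+1}^{s_{d+1}}t^n]F(1,z_2,\dots,z_{d+1},t)$ is the number of permutations $\sigma$ of $\{1,\dots,n\}$ with $i-d\le\sigma(i)\le i+1$ for all $i$ that have exactly $s_k$ cycles of length $k$ for every $2\le k\le d+1$. These coefficients satisfy a local central limit theorem, as follows. As $n\to\infty$, the maximum coefficient of $[t^n]F(1,z_2,\dots,z_{d+1},t)$, as a polynomial in $z_2,\dots,z_{d+1}$, is asymptotically equivalent (ratio tending to $1$) to $$A_n=\frac{\rho^{-n}n^{-d/2}}{-\rho h'(\rho)(2\pi)^{d/2}}\sqrt{\frac{(1+2\rho+\cdots+(d+1)\rho^d)^{d+2}}{(1+\rho+\cdots+\rho^d)\,\rho^{d(d+1)/2}}}.$$ Furthermore,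 $$\sup_{s_2,\dots,s_{d+1}\in\mathbb N}\left|\frac{[z_2^{s_2}\cdots z_{d+1}^{s_{d+1}}t^n]F(1,z_2,\dots,z_{d+1},t)}{A_n}-v_n(s_2,\dots,s_{d+1})\right|\longrightarrow 0,$$ where $$v_n(\mathbf s)=\exp\left[-\frac{(\mathbf s-n\mathbf m)\,\mathcal H^{-1}(\mathbf s-n\mathbf m)^T}{2n}\right],\qquad \mathbf m=\left(-\frac{\rho}{h'(\rho)},-\frac{\rho^2}{h'(\rho)},\dots,-\frac{\rho^{d}}{h'(\rho)}\right),$$ and $\mathcal H$ is the $d\times d$ matrix with entries, for $1\le i,j\le d$, $$\mathcal H_{i,j}=\begin{cases}\dfrac{\rho^{i+j+1}h''(\rho)-\rho^{i+j}(1+i+j)h'(\rho)}{h'(\rho)^3}& i\ne j,\\[3mm]\dfrac{\rho^{i+j+1}h''(\rho)-\rho^{i+j}(1+i+j)h'(\rho)-\rho^ih'(\rho)^2}{h'(\rho)^3}& i=j,\end{cases}$$ which is non-singular. -/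

import Mathlib

open Filter Topology Asymptotics
open scoped ENNReal

namespace BandedPerm

noncomputable section

/-- The denominator `1 - z₁ t - z₂ t² - ⋯ - z_{d+1} t^{d+1}`, as a power series in `t` over a
commutative ring containing the `z`'s. The entry `z i` (`i : Fin (d + 1)`) is `z_{i+1}`. -/
def denom {R : Type*} [CommRing R] (d : ℕ) (z : Fin (d + 1) → R) : PowerSeries R :=
  1 - ∑ i : Fin (d + 1), PowerSeries.C (z i) * PowerSeries.X ^ ((i : ℕ) + 1)

/-- The power series expansion in `t` of
`F(z₁, …, z_{d+1}, t) = 1 / (1 - z₁ t - z₂ t² - ⋯ - z_{d+1} t^{d+1})`. -/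
def F {R : Type*} [CommRing R] (d : ℕ) (z : Fin (d + 1) → R) : PowerSeries R :=
  PowerSeries.invOfUnit (denom d z) 1

/-- `F` is the multiplicative inverse of its denominator. -/
theorem denom_mul_F {R : Type*} [CommRing R] (d : ℕ) (z : Fin (d + 1) → R) :
    denom d z * F d z = 1 := by
  apply PowerSeries.mul_invOfUnit
  simp [denom]

/-- The polynomial `[tⁿ] F(1, z₂, …, z_{d+1}, t)` in the `d` variables `z₂, …, z_{d+1}`;
the variable `X i` (`i : Fin d`) is `z_{i+2}`. -/
def slice (d n : ℕ) : MvPolynomial (Fin d) ℝ :=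
  PowerSeries.coeff n (F d (Fin.cons 1 MvPolynomial.X))

/-- The maximum coefficient of a polynomial. -/
def maxCoeff {σ : Type*} (p : MvPolynomial σ ℝ) : ℝ :=
  ⨆ s : σ →₀ ℕ, p.coeff s

/-- The supremum in `maxCoeff` is attained. -/
theorem isGreatest_maxCoeff {σ : Type*} (p : MvPolynomial σ ℝ) :
    IsGreatest (Set.range fun s : σ →₀ ℕ => p.coeff s) (maxCoeff p) := by
  have hfin : (Set.range fun s : σ →₀ ℕ => p.coeff s).Finite := by
    refine ((p.support.finite_toSet.image fun s => p.coeff s).insert 0).subset ?_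
    rintro _ ⟨s, rfl⟩
    by_cases hs : p.coeff s = 0
    · exact Or.inl hs
    · exact Or.inr ⟨s, by simpa using hs, rfl⟩
  exact ⟨(Set.range_nonempty _).csSup_mem hfin, fun _ hx => le_csSup hfin.bddAbove hx⟩

/-- The polynomial `h(t) = 1 - t - ⋯ - t^{d+1}`. -/
def h (d : ℕ) : Polynomial ℝ :=
  1 - ∑ i ∈ Finset.range (d + 1), Polynomial.X ^ (i + 1)

/-- The value `h'(ρ)`. -/
def h1 (d : ℕ) (ρ : ℝ) : ℝ := (h d).derivative.eval ρ

/-- The value `h''(ρ)`. -/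
def h2 (d : ℕ) (ρ : ℝ) : ℝ := (h d).derivative.derivative.eval ρ

/-- The asymptotic size `A_n` of the maximum coefficient. -/
def A (d : ℕ) (ρ : ℝ) (n : ℕ) : ℝ :=
  (ρ ^ n)⁻¹ * (n : ℝ) ^ (-(d : ℝ) / 2) / (-ρ * h1 d ρ * (2 * Real.pi) ^ ((d : ℝ) / 2)) *
    Real.sqrt ((∑ i ∈ Finset.range (d + 1), ((i : ℝ) + 1) * ρ ^ i) ^ (d + 2) /
      ((∑ i ∈ Finset.range (d + 1), ρ ^ i) * ρ ^ (d * (d + 1) / 2)))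

/-- The mean vector `m = (-ρ / h'(ρ), -ρ² / h'(ρ), …, -ρᵈ / h'(ρ))`. -/
def m (d : ℕ) (ρ : ℝ) : Fin d → ℝ :=
  fun i => -ρ ^ ((i : ℕ) + 1) / h1 d ρ

/-- The entry `ℋ_{i,j}` for indices `1 ≤ i, j ≤ d`. -/
def hessEntry (d : ℕ) (ρ : ℝ) (i j : ℕ) : ℝ :=
  if i = j then
    (ρ ^ (i + j + 1) * h2 d ρ - ρ ^ (i + j) * (1 + i + j) * h1 d ρ - ρ ^ i * h1 d ρ ^ 2) /
      h1 d ρ ^ 3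
  else
    (ρ ^ (i + j + 1) * h2 d ρ - ρ ^ (i + j) * (1 + i + j) * h1 d ρ) / h1 d ρ ^ 3

/-- The covariance matrix `ℋ`. -/
def hess (d : ℕ) (ρ : ℝ) : Matrix (Fin d) (Fin d) ℝ :=
  Matrix.of fun i j => hessEntry d ρ ((i : ℕ) + 1) ((j : ℕ) + 1)

/-- The unnormalized Gaussian `v_n(s) = exp(-(s - n m) ℋ⁻¹ (s - n m)ᵀ / (2 n))`. -/
def v (d : ℕ) (ρ : ℝ) (n : ℕ) (s : Fin d → ℝ) : ℝ :=
  Real.exp (-((s - (n : ℝ) • m d ρ) ⬝ᵥ (hess d ρ)⁻¹.mulVec (s - (n : ℝ) • m d ρ)) / (2 * n))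

/-- The number of permutations `σ` of an `n`-element linearly ordered set `{1, …, n}` such that
`i - d ≤ σ(i) ≤ i + 1` for all `i` and such that `σ` has exactly `s_k` cycles of length `k` for
every `2 ≤ k ≤ d + 1`; the entry `s i` (`i : Fin d`) is `s_{i+2}`. Points are labelled from `0`
here, which does not affect the two inequalities. -/
def permCount (d n : ℕ) (s : Fin d → ℕ) : ℕ :=
  Nat.card {σ : Equiv.Perm (Fin n) //
    (∀ i : Fin n, (i : ℕ) ≤ (σ i : ℕ) + d ∧ (σ i : ℕ) ≤ (i : ℕ) + 1) ∧
      ∀ k : Fin d, σ.cycleType.count ((k : ℕ) + 2) = s k}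

end

end BandedPerm

/-! If no point moves up by more than one, the cycle of the last point is an interval run through
upwards and closed by one jump down, which the band limits to length `d + 1`. Removing it leaves a
banded permutation of the points below. Banded permutations are thus compositions of `n` into parts
`1, …, d + 1`, cycle lengths being parts. `permCount`, the coefficients of `slice` and the
multinomial coefficients satisfy the same recursion `CompositionRec`, hence agree.

Since `h(ρ) = 0`, the numbers `p i = ρ ^ (i + 1)` are probabilities, and `ρ ^ n` times a coefficient
is the multinomial probability `mass p a` of the vector `a` of multiplicities. The number of trials
`N`, the number of parts, varies with `a`, while the weight `∑ (i + 1) a i = n` is fixed. Stirling's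
formula writes `mass` exactly as a subexponential prefactor times `exp (-entropy)` (`mass_eq`).

Where Pearson's statistic stays bounded, the frequencies converge to `p`, the prefactor converges
and entropy may be replaced by `pearson`. Where it tends to infinity, both probability and Gaussian
vanish, because entropy dominates `pearson` and the prefactor is polynomial in it.
`tendsto_of_le_or_tendsto_atTop` joins the two cases into a limit uniform in `a`. Finally `n / N`
tends to the mean `μ` in the bounded case, and inverting `ℋ` explicitly identifies `μ N pearson / n`
with the exponent of `v` (`v_eq_exp_pearson`). -/

namespace BandedPerm

/-! ### Cycle types of block permutations -/

theorem cycleType_permCongr {α β : Type*} [Fintype α] [DecidableEq α] [Fintype β] [DecidableEq β]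
    (e : α ≃ β) (σ : Equiv.Perm α) : (e.permCongr σ).cycleType = σ.cycleType := by
  have key : e.permCongr σ =
      σ.extendDomain (p := fun _ => True) (e.trans (Equiv.subtypeUnivEquiv fun _ => trivial).symm) := by
    ext b
    obtain ⟨a, rfl⟩ := e.surjective b
    have := Equiv.Perm.extendDomain_apply_image (p := fun _ : β => True) σ
      (e.trans (Equiv.subtypeUnivEquiv fun _ => trivial).symm) a
    simpa using this.symm
  rw [key, Equiv.Perm.cycleType_extendDomain]

/-- The permutation is a product of two disjoint ones, each the extension by the identity of one
summand. -/
theorem cycleType_sumCongr {α β : Type*} [Fintype α] [DecidableEq α] [Fintype β] [DecidableEq β]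
    (σ : Equiv.Perm α) (τ : Equiv.Perm β) :
    (Equiv.Perm.sumCongr σ τ).cycleType = σ.cycleType + τ.cycleType := by
  have hl : Equiv.Perm.sumCongr σ (1 : Equiv.Perm β) =
      σ.extendDomain (Equiv.ofInjective (Sum.inl : α → α ⊕ β) Sum.inl_injective) := by
    ext (a | b)
    · have := Equiv.Perm.extendDomain_apply_image σ
        (Equiv.ofInjective (Sum.inl : α → α ⊕ β) Sum.inl_injective) a
      simpa using this.symm
    · rw [Equiv.Perm.extendDomain_apply_not_subtype _ _ (by simp)]
      simp
  have hr : Equiv.Perm.sumCongr (1 : Equiv.Perm α) τ =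
      τ.extendDomain (Equiv.ofInjective (Sum.inr : β → α ⊕ β) Sum.inr_injective) := by
    ext (a | b)
    · rw [Equiv.Perm.extendDomain_apply_not_subtype _ _ (by simp)]
      simp
    · have := Equiv.Perm.extendDomain_apply_image τ
        (Equiv.ofInjective (Sum.inr : β → α ⊕ β) Sum.inr_injective) b
      simpa using this.symm
  have hd : (Equiv.Perm.sumCongr σ (1 : Equiv.Perm β)).Disjoint
      (Equiv.Perm.sumCongr (1 : Equiv.Perm α) τ) := by
    rintro (a | b)
    · right; simp
    · left; simp
  have hm : Equiv.Perm.sumCongr σ τ =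
      Equiv.Perm.sumCongr σ (1 : Equiv.Perm β) * Equiv.Perm.sumCongr (1 : Equiv.Perm α) τ := by
    rw [Equiv.Perm.sumCongr_mul, mul_one, one_mul]
  rw [hm, hd.cycleType_mul, hl, hr, Equiv.Perm.cycleType_extendDomain,
    Equiv.Perm.cycleType_extendDomain]

/-! ### Decomposition of banded permutations -/

/-- The band condition `i - d ≤ σ i ≤ i + 1`. -/
def IsBanded (d : ℕ) {n : ℕ} (σ : Equiv.Perm (Fin n)) : Prop :=
  ∀ i : Fin n, (i : ℕ) ≤ (σ i : ℕ) + d ∧ (σ i : ℕ) ≤ (i : ℕ) + 1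

/-- Place a `(k + 1)`-cycle on the points `m, …, m + k` next to a permutation of the points below
`m`. -/
def appendCycle {m : ℕ} (k : ℕ) (τ : Equiv.Perm (Fin m)) : Equiv.Perm (Fin (m + (k + 1))) :=
  finSumFinEquiv.permCongr (Equiv.Perm.sumCongr τ (finRotate (k + 1)))

theorem appendCycle_castAdd {m k : ℕ} (τ : Equiv.Perm (Fin m)) (i : Fin m) :
    appendCycle k τ (Fin.castAdd (k + 1) i) = Fin.castAdd (k + 1) (τ i) := by
  simp [appendCycle, Equiv.permCongr_apply]

theorem appendCycle_natAdd {m k : ℕ} (τ : Equiv.Perm (Fin m)) (i : Fin (k + 1)) :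
    appendCycle k τ (Fin.natAdd m i) = Fin.natAdd m (finRotate (k + 1) i) := by
  simp [appendCycle, Equiv.permCongr_apply]

theorem cycleType_appendCycle {m : ℕ} (k : ℕ) (τ : Equiv.Perm (Fin m)) :
    (appendCycle k τ).cycleType = τ.cycleType + (finRotate (k + 1)).cycleType := by
  rw [appendCycle, cycleType_permCongr, cycleType_sumCongr]

theorem appendCycle_injective {m k : ℕ} :
    Function.Injective (appendCycle k : Equiv.Perm (Fin m) → _) := by
  intro τ τ' h
  ext i
  have := congrArg (fun σ => (σ (Fin.castAdd (k + 1) i) : ℕ)) h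
  simpa [appendCycle_castAdd] using this

/-- On the new block all points move up by one except the last, which drops by `k`; this is where `k
≤ d` enters. -/
theorem isBanded_appendCycle {d m k : ℕ} (hk : k ≤ d) (τ : Equiv.Perm (Fin m)) :
    IsBanded d (appendCycle k τ) ↔ IsBanded d τ := by
  constructor
  · intro h i
    simpa [appendCycle_castAdd] using h (Fin.castAdd (k + 1) i)
  · intro h i
    induction i using Fin.addCases with
    | left i => simpa [appendCycle_castAdd] using h i
    | right i =>
      rw [appendCycle_natAdd]
      simp only [Fin.val_natAdd, coe_finRotate]
      have := i.isLt
      split_ifs <;> omega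

theorem appendCycle_last {m k : ℕ} (τ : Equiv.Perm (Fin m)) (i : Fin (m + (k + 1)))
    (hi : (i : ℕ) = m + k) : (appendCycle k τ i : ℕ) = m := by
  have : i = Fin.natAdd m (Fin.last k) := by ext; simp [hi]
  rw [this, appendCycle_natAdd, finRotate_last]
  simp

/-- In a permutation that moves no point up by more than one, the cycle of the last point is an
interval, run through upwards. -/
theorem apply_eq_succ_of_le_succ {m k : ℕ} (σ : Equiv.Perm (Fin (m + (k + 1))))
    (hσ : ∀ i, (σ i : ℕ) ≤ (i : ℕ) + 1)
    (hlast : ∀ i : Fin (m + (k + 1)), (i : ℕ) = m + k → (σ i : ℕ) = m) (r : ℕ) :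
    ∀ i : Fin (m + (k + 1)), m ≤ (i : ℕ) → (i : ℕ) + 1 + r = m + k → (σ i : ℕ) = i + 1 := by
  induction r using Nat.strong_induction_on with
  | _ r ih =>
    intro i hmi hir
    -- The preimage `j` of `i + 1` cannot lie below `i`. If it lay above, its image would be `j + 1`
    -- by induction, or `m` for the last point, and neither equals `i + 1`.
    set j := σ.symm ⟨(i : ℕ) + 1, by omega⟩ with hj
    have hσj : (σ j : ℕ) = i + 1 := by simp [hj]
    have hlow := hσ j
    have hjlt := j.isLt
    rcases lt_trichotomy (j : ℕ) i with hji | hji | hji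
    · omega
    · rw [← Fin.ext hji]; rw [hσj, hji]
    · rcases Nat.lt_or_ge (j : ℕ) (m + k) with hjk | hjk
      · have := ih (m + k - (j + 1)) (by omega) j (by omega) (by omega)
        omega
      · have := hlast j (by omega)
        omega

/-- The top block is rotated within itself, so by injectivity the points below `m` are also
preserved and `σ` splits as a sum. -/
theorem exists_eq_appendCycle {m k : ℕ} (σ : Equiv.Perm (Fin (m + (k + 1))))
    (hσ : ∀ i, (σ i : ℕ) ≤ (i : ℕ) + 1)
    (hlast : ∀ i : Fin (m + (k + 1)), (i : ℕ) = m + k → (σ i : ℕ) = m) :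
    ∃ τ, appendCycle k τ = σ := by
  have hnat : ∀ i : Fin (k + 1), σ (Fin.natAdd m i) = Fin.natAdd m (finRotate (k + 1) i) := by
    intro i
    ext
    simp only [Fin.val_natAdd, coe_finRotate]
    split_ifs with hi
    · rw [hlast _ (by simp [hi])]; rfl
    · have hne : (i : ℕ) ≠ k := fun h => hi (Fin.ext h)
      have := i.isLt
      rw [apply_eq_succ_of_le_succ σ hσ hlast (k - (i + 1)) _ (by simp) (by simp; omega)]
      simp; omega
  set σ' := (finSumFinEquiv (m := m) (n := k + 1)).symm.permCongr σ with hσ'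
  have hinr : ∀ i, σ' (Sum.inr i) = Sum.inr (finRotate (k + 1) i) := by
    intro i
    simp [hσ', Equiv.permCongr_apply, hnat]
  have hmaps : Set.MapsTo σ' (Set.range Sum.inl) (Set.range Sum.inl) := by
    rintro _ ⟨a, rfl⟩
    rcases hc : σ' (Sum.inl a) with b | b
    · exact ⟨b, rfl⟩
    · have h1 := hinr ((finRotate (k + 1)).symm b)
      rw [Equiv.apply_symm_apply, ← hc] at h1
      exact absurd (σ'.injective h1) (by simp)
  obtain ⟨⟨τ, ρ⟩, hτ⟩ := Equiv.Perm.mem_sumCongrHom_range_of_perm_mapsTo_inl hmaps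
  have hτ' : Equiv.Perm.sumCongr τ ρ = σ' := hτ
  have hρ : ρ = finRotate (k + 1) := by
    ext1 i
    have := hinr i
    rw [← hτ'] at this
    simpa using this
  refine ⟨τ, ?_⟩
  rw [appendCycle, ← hρ, hτ', hσ']
  ext i
  simp [Equiv.permCongr_apply]

/-- The banded permutations with prescribed numbers of cycles of length at least two. -/
abbrev BandedWith (d n : ℕ) (s : Fin d → ℕ) : Type :=
  {σ : Equiv.Perm (Fin n) // IsBanded d σ ∧ ∀ k : Fin d, σ.cycleType.count ((k : ℕ) + 2) = s k}

theorem permCount_eq_card (d n : ℕ) (s : Fin d → ℕ) : permCount d n s = Nat.card (BandedWith d n s) :=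
  rfl

/-- Removing the cycle of the last point, of length `k + 1`. -/
theorem card_bandedWith_last {d m k : ℕ} (hk : k ≤ d) (s : Fin d → ℕ) :
    Nat.card {σ : BandedWith d (m + (k + 1)) s //
        ∀ i : Fin (m + (k + 1)), (i : ℕ) = m + k → (σ.1 i : ℕ) = m} =
      Nat.card {τ : Equiv.Perm (Fin m) // IsBanded d τ ∧ ∀ j : Fin d,
        τ.cycleType.count ((j : ℕ) + 2) + (if (j : ℕ) + 1 = k then 1 else 0) = s j} := by
  have hct : ∀ (τ : Equiv.Perm (Fin m)) (j : Fin d),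
      (appendCycle k τ).cycleType.count ((j : ℕ) + 2) =
        τ.cycleType.count ((j : ℕ) + 2) + (if (j : ℕ) + 1 = k then 1 else 0) := by
    intro τ j
    rw [cycleType_appendCycle, Multiset.count_add]
    congr 1
    rcases k with _ | k
    · have : finRotate (0 + 1) = 1 := finRotate_one
      simp [this]
    · rw [cycleType_finRotate, Multiset.count_singleton]
      simp
  symm
  refine Nat.card_congr (Equiv.ofBijective (fun τ => ⟨⟨appendCycle k τ.1,
    (isBanded_appendCycle hk _).2 τ.2.1, fun j => by rw [hct]; exact τ.2.2 j⟩,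
    fun i hi => appendCycle_last _ _ hi⟩) ⟨?_, ?_⟩)
  · intro τ τ' h
    simp only [Subtype.mk.injEq] at h
    exact Subtype.ext (appendCycle_injective h)
  · rintro ⟨⟨σ, hσ, hs⟩, hl⟩
    obtain ⟨τ, rfl⟩ := exists_eq_appendCycle σ (fun i => (hσ i).2) hl
    exact ⟨⟨τ, (isBanded_appendCycle hk _).1 hσ, fun j => by rw [← hct]; exact hs j⟩, rfl⟩

/-- The case `s j = 0` is separate because the subtraction in `s - Finsupp.single j 1` truncates; no
permutation then contains the removed cycle. -/
theorem card_bandedWith_add_one {d m k : ℕ} (s : Fin d →₀ ℕ) (j : Fin d) (hj : (j : ℕ) + 1 = k) :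
    Nat.card {τ : Equiv.Perm (Fin m) // IsBanded d τ ∧ ∀ i : Fin d,
        τ.cycleType.count ((i : ℕ) + 2) + (if (i : ℕ) + 1 = k then 1 else 0) = s i} =
      if s j ≠ 0 then permCount d m (s - Finsupp.single j 1 : Fin d →₀ ℕ) else 0 := by
  subst hj
  have hiff : ∀ i : Fin d, (i : ℕ) + 1 = (j : ℕ) + 1 ↔ i = j := fun i => by
    rw [Fin.ext_iff]; omega
  simp only [hiff]
  split_ifs with h
  · rw [permCount_eq_card]
    refine Nat.card_congr (Equiv.subtypeEquivRight fun τ => and_congr_right fun _ =>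
      forall_congr' fun i => ?_)
    rw [Finsupp.tsub_apply, Finsupp.single_apply]
    by_cases hij : i = j
    · subst hij; simp only [if_true]; omega
    · simp [hij, Ne.symm hij]
  · have : IsEmpty {τ : Equiv.Perm (Fin m) // IsBanded d τ ∧ ∀ i : Fin d,
        τ.cycleType.count ((i : ℕ) + 2) + (if i = j then 1 else 0) = s i} := by
      refine ⟨fun τ => ?_⟩
      have := τ.2.2 j
      simp only [if_true] at this
      omega
    exact Nat.card_of_isEmpty

theorem permCount_succ (d n : ℕ) (s : Fin d →₀ ℕ) :
    permCount d (n + 1) s = permCount d n s +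
      ∑ j : Fin d, if (j : ℕ) + 2 ≤ n + 1 ∧ s j ≠ 0 then
        permCount d (n + 1 - (j + 2)) (s - Finsupp.single j 1 : Fin d →₀ ℕ) else 0 := by
  -- The last point is sent to the least point of its cycle, so `f σ + 1` is the length of that
  -- cycle. The fibre over `0` is a fixed point, which `s` does not record.
  set f : BandedWith d (n + 1) s → Fin (d + 1) := fun σ =>
    ⟨n - (σ.1 (Fin.last n) : ℕ), by have := (σ.2.1 (Fin.last n)).1; simp at this; omega⟩ with hf
  rw [permCount_eq_card, ← Nat.card_congr (Equiv.sigmaFiberEquiv f), Nat.card_sigma,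
    Fin.sum_univ_succ]
  have key : ∀ (k : Fin (d + 1)) (m : ℕ), m + ((k : ℕ) + 1) = n + 1 →
      Nat.card {σ // f σ = k} = Nat.card {τ : Equiv.Perm (Fin m) // IsBanded d τ ∧ ∀ j : Fin d,
        τ.cycleType.count ((j : ℕ) + 2) + (if (j : ℕ) + 1 = k then 1 else 0) = s j} := by
    intro k m hm
    rw [← card_bandedWith_last (by omega)]
    obtain rfl : n = m + k := by omega
    refine Nat.card_congr (Equiv.subtypeEquivRight fun σ => ?_)
    rw [hf, Fin.ext_iff]
    have hlt := (σ.1 (Fin.last (m + k))).isLt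
    constructor
    · intro h i hi
      obtain rfl : i = Fin.last (m + k) := Fin.ext hi
      simp only at h
      omega
    · intro h
      have := h (Fin.last (m + k)) rfl
      simp only
      omega
  congr 1
  · rw [key 0 n (by simp)]
    rw [permCount_eq_card]
    simp [BandedWith]
  · refine Finset.sum_congr rfl fun j _ => ?_
    by_cases hj : (j : ℕ) + 2 ≤ n + 1
    · rw [key j.succ (n + 1 - (j + 2)) (by simp; omega), card_bandedWith_add_one s j (by simp)]
      simp [hj]
    · have : IsEmpty {σ // f σ = j.succ} := by
        refine ⟨fun σ => ?_⟩
        have := congrArg Fin.val σ.2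
        simp only [hf, Fin.val_succ] at this
        omega
      rw [Nat.card_of_isEmpty, if_neg (by tauto)]

theorem permCount_zero (d : ℕ) (s : Fin d →₀ ℕ) : permCount d 0 s = if s = 0 then 1 else 0 := by
  rw [permCount_eq_card]
  split_ifs with h
  · subst h
    rw [Nat.card_eq_one_iff_unique]
    refine ⟨inferInstance, ⟨⟨1, fun i => i.elim0, fun k => by simp⟩⟩⟩
  · have : IsEmpty (BandedWith d 0 s) := by
      refine ⟨fun σ => h ?_⟩
      ext k
      rw [← σ.2.2 k, Subsingleton.elim σ.1 1]
      simp
    exact Nat.card_of_isEmpty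

/-! ### The composition recursion -/

/-- The recursion satisfied by the number of compositions of `n` into parts from `1, …, d + 1` with
`s k` parts equal to `k + 2`. -/
def CompositionRec {d : ℕ} (f : ℕ → (Fin d →₀ ℕ) → ℝ) : Prop :=
  (∀ s, f 0 s = if s = 0 then 1 else 0) ∧ ∀ n s, f (n + 1) s = f n s +
    ∑ j : Fin d, if (j : ℕ) + 2 ≤ n + 1 ∧ s j ≠ 0 then
      f (n + 1 - (j + 2)) (s - Finsupp.single j 1) else 0

theorem CompositionRec.eq {d : ℕ} {f g : ℕ → (Fin d →₀ ℕ) → ℝ} (hf : CompositionRec f)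
    (hg : CompositionRec g) (n : ℕ) : f n = g n := by
  induction n using Nat.strong_induction_on with
  | _ n ih =>
    rcases n with _ | n
    · ext s; rw [hf.1, hg.1]
    · ext s
      rw [hf.2, hg.2, ih n (by omega)]
      congr 1
      refine Finset.sum_congr rfl fun j _ => ?_
      rw [ih (n + 1 - (j + 2)) (by omega)]

theorem compositionRec_permCount (d : ℕ) :
    CompositionRec fun n (s : Fin d →₀ ℕ) => (permCount d n s : ℝ) := by
  refine ⟨fun s => ?_, fun n s => ?_⟩
  · simp only [permCount_zero]; split_ifs <;> simp
  · simp only [permCount_succ]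
    push_cast
    rfl

theorem coeff_F {R : Type*} [CommRing R] (d : ℕ) (z : Fin (d + 1) → R) (n : ℕ) :
    PowerSeries.coeff n (F d z) = (if n = 0 then 1 else 0) +
      ∑ i : Fin (d + 1), z i * if (i : ℕ) + 1 ≤ n then PowerSeries.coeff (n - (i + 1)) (F d z) else 0 := by
  have h := congrArg (PowerSeries.coeff n) (denom_mul_F d z)
  rw [denom, sub_mul, one_mul, Finset.sum_mul, map_sub, map_sum, PowerSeries.coeff_one,
    sub_eq_iff_eq_add] at h
  rw [h]
  congr 1
  refine Finset.sum_congr rfl fun i _ => ?_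
  rw [mul_assoc, PowerSeries.coeff_C_mul, mul_comm (PowerSeries.X ^ _), PowerSeries.coeff_mul_X_pow']

theorem compositionRec_slice (d : ℕ) : CompositionRec fun n (s : Fin d →₀ ℕ) => (slice d n).coeff s := by
  refine ⟨fun s => ?_, fun n s => ?_⟩
  · simp only [slice]
    rw [coeff_F]
    simp [MvPolynomial.coeff_one, eq_comm]
  · simp only [slice]
    rw [coeff_F, Fin.sum_univ_succ, if_neg (by omega), zero_add, MvPolynomial.coeff_add,
      MvPolynomial.coeff_sum]
    congr 1
    · simp
    · refine Finset.sum_congr rfl fun j _ => ?_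
      rw [Fin.cons_succ, MvPolynomial.coeff_X_mul']
      simp only [Finsupp.mem_support_iff, Fin.val_succ]
      by_cases h1 : (j : ℕ) + 2 ≤ n + 1
      · rw [if_pos (show (j : ℕ) + 1 + 1 ≤ n + 1 by omega)]
        by_cases h2 : s j ≠ 0
        · rw [if_pos h2, if_pos ⟨h1, h2⟩]
        · rw [if_neg h2, if_neg (by tauto)]
      · rw [if_neg (show ¬ (j : ℕ) + 1 + 1 ≤ n + 1 by omega), 
          if_neg (show ¬ ((j : ℕ) + 2 ≤ n + 1 ∧ s j ≠ 0) from fun h => h1 h.1)]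
        simp

theorem coeff_slice_eq_permCount (d n : ℕ) (s : Fin d →₀ ℕ) :
    (slice d n).coeff s = (permCount d n s : ℝ) :=
  congrFun ((compositionRec_slice d).eq (compositionRec_permCount d) n) s

/-! ### The explicit formula -/

theorem multinomial_add_single {ι : Type*} [Fintype ι] [DecidableEq ι] (b : ι → ℕ) (i : ι) :
    (b i + 1) * Nat.multinomial Finset.univ (b + Pi.single i 1) =
      (∑ j, b j + 1) * Nat.multinomial Finset.univ b := by
  have hs : ∑ j, (b + Pi.single i 1 : ι → ℕ) j = ∑ j, b j + 1 := by
    simp [Finset.sum_add_distrib]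
  have hp : ∏ j, ((b + Pi.single i 1 : ι → ℕ) j).factorial = (b i + 1) * ∏ j, (b j).factorial := by
    rw [← Finset.mul_prod_erase _ _ (Finset.mem_univ i),
      ← Finset.mul_prod_erase _ (fun j => (b j).factorial) (Finset.mem_univ i), ← mul_assoc]
    congr 1
    · simp [Nat.factorial_succ]
    · refine Finset.prod_congr rfl fun j hj => ?_
      simp [Finset.ne_of_mem_erase hj]
  have h1 := Nat.multinomial_spec Finset.univ (b + Pi.single i 1)
  have h2 := Nat.multinomial_spec Finset.univ b
  rw [hs, hp, Nat.factorial_succ, ← h2] at h1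
  have hpos : 0 < ∏ j, (b j).factorial := Finset.prod_pos fun j _ => Nat.factorial_pos _
  refine Nat.eq_of_mul_eq_mul_left hpos ?_
  linear_combination h1

/-- Pascal's rule: `a i` times the multinomial coefficient of `a` is `N` times that of `a -
Pi.single i 1`, where `N = ∑ i, a i`; sum over `i` and cancel `N`. -/
theorem multinomial_eq_sum {ι : Type*} [Fintype ι] [DecidableEq ι] (a : ι → ℕ) (ha : a ≠ 0) :
    Nat.multinomial Finset.univ a =
      ∑ i, if a i ≠ 0 then Nat.multinomial Finset.univ (a - Pi.single i 1) else 0 := by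
  have hN : 0 < ∑ j, a j := by
    obtain ⟨i, hi⟩ := Function.ne_iff.1 ha
    exact lt_of_lt_of_le (Nat.pos_of_ne_zero hi) (Finset.single_le_sum (fun _ _ => Nat.zero_le _)
      (Finset.mem_univ i))
  refine Nat.eq_of_mul_eq_mul_left hN ?_
  rw [Finset.sum_mul, Finset.mul_sum]
  refine Finset.sum_congr rfl fun i _ => ?_
  split_ifs with h
  · have hb : a = (a - Pi.single i 1) + Pi.single i 1 := by
      ext j
      by_cases hj : j = i
      · subst hj; simp; omega
      · simp [hj]
    set b := a - Pi.single i 1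
    have := multinomial_add_single b i
    have hs : ∑ j, a j = ∑ j, b j + 1 := by rw [hb]; simp [Finset.sum_add_distrib]
    rw [hs, ← this, hb]
    simp
  · simp [not_not.1 h]

/-- The size of the part of a composition that consists of the parts greater than one. -/
def tailWeight {d : ℕ} (s : Fin d → ℕ) : ℕ := ∑ k : Fin d, ((k : ℕ) + 2) * s k

/-- The vector of all multiplicities of a composition of `n`, given those of the parts greater than
one. -/
def multiplicities {d : ℕ} (n : ℕ) (s : Fin d → ℕ) : Fin (d + 1) → ℕ :=
  Fin.cons (n - tailWeight s) s

theorem tailWeight_sub_single {d : ℕ} (s : Fin d →₀ ℕ) (j : Fin d) (hj : s j ≠ 0) :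
    tailWeight (s - Finsupp.single j 1 : Fin d →₀ ℕ) + (j + 2) = tailWeight s := by
  have hb : s = (s - Finsupp.single j 1) + Finsupp.single j 1 := by
    rw [tsub_add_cancel_of_le]
    rw [Finsupp.single_le_iff]; omega
  conv_rhs => rw [hb]
  simp only [tailWeight, Finsupp.add_apply, mul_add, Finset.sum_add_distrib]
  congr 1
  simp [Finsupp.single_apply]

/-- This is Pascal's rule sorted by the removed part: a part `1` lowers `n` alone, a part `j + 2`
lowers `n` and `s j`. The guard `tailWeight s ≤ n` keeps the number of ones from being truncated. -/
theorem compositionRec_multinomial (d : ℕ) : CompositionRec fun n (s : Fin d →₀ ℕ) =>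
    if tailWeight s ≤ n then (Nat.multinomial Finset.univ (multiplicities n s) : ℝ) else 0 := by
  refine ⟨fun s => ?_, fun n s => ?_⟩
  · by_cases h : s = 0
    · subst h
      simp [tailWeight, multiplicities, Nat.multinomial, Fin.sum_univ_succ, Fin.prod_univ_succ]
    · have : 0 < tailWeight s := by
        obtain ⟨j, hj⟩ := Finsupp.ne_iff.1 h
        have := tailWeight_sub_single s j (by simpa using hj)
        omega
      simp [h, this.ne']
  · by_cases h : tailWeight s ≤ n + 1
    · have hne : multiplicities (n + 1) s ≠ 0 := by
        intro h0
        have hs : ∀ k, s k = 0 := fun k => by simpa [multiplicities] using congrFun h0 k.succ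
        have := congrFun h0 0
        simp [multiplicities, tailWeight, hs] at this
      simp only [if_pos h]
      rw [multinomial_eq_sum _ hne, Fin.sum_univ_succ]
      push_cast
      congr 1
      · by_cases h' : tailWeight s ≤ n
        · rw [if_pos h', if_pos (by simp [multiplicities]; omega)]
          congr 2
          ext i
          refine Fin.cases ?_ (fun i => ?_) i
          · simp [multiplicities]; omega
          · simp [multiplicities]
        · rw [if_neg h', if_neg (by simp [multiplicities]; omega)]
      · refine Finset.sum_congr rfl fun j _ => ?_
        by_cases hj : s j ≠ 0
        · have hw := tailWeight_sub_single s j hj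
          rw [Finsupp.coe_tsub] at hw
          rw [if_pos (by simpa [multiplicities] using hj), if_pos ⟨by omega, hj⟩, if_pos (by omega)]
          congr 2
          ext i
          refine Fin.cases ?_ (fun i => ?_) i
          · simp only [multiplicities, Pi.sub_apply, Fin.cons_zero]
            rw [Pi.single_eq_of_ne (Fin.succ_ne_zero j).symm]
            omega
          · by_cases hij : i = j
            · subst hij; simp [multiplicities]
            · simp [multiplicities, hij]
        · rw [if_neg (by simpa [multiplicities] using hj), if_neg (by tauto)]
    · simp only [if_neg h]
      rw [if_neg (by omega), zero_add, Finset.sum_eq_zero]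
      intro j _
      split_ifs with h1 h2
      · have := tailWeight_sub_single s j h1.2
        omega
      · rfl
      · rfl

theorem coeff_slice_eq_multinomial (d n : ℕ) (s : Fin d →₀ ℕ) :
    (slice d n).coeff s =
      if tailWeight s ≤ n then (Nat.multinomial Finset.univ (multiplicities n s) : ℝ) else 0 :=
  congrFun ((compositionRec_slice d).eq (compositionRec_multinomial d) n) s

open InformationTheory (klFun)

/-! ### Filters -/

/-- Convergence can be tested on ultrafilters, and along an ultrafilter `T` is either eventually
bounded above or tends to infinity. This replaces a cut-off between centre and tails. -/
theorem tendsto_of_le_or_tendsto_atTop {α : Type*} {l : Filter α} {T f : α → ℝ} {c : Filter ℝ}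
    (h1 : ∀ l' ≤ l, ∀ K, (∀ᶠ a in l', T a ≤ K) → Tendsto f l' c)
    (h2 : ∀ l' ≤ l, Tendsto T l' atTop → Tendsto f l' c) : Tendsto f l c := by
  rw [tendsto_iff_ultrafilter]
  intro g hg
  by_cases h : ∃ K, ∀ᶠ a in (g : Filter α), T a ≤ K
  · obtain ⟨K, hK⟩ := h
    exact h1 g hg K hK
  · push Not at h
    refine h2 g hg (tendsto_atTop.2 fun K => ?_)
    exact (h K).mono fun a ha => ha.le

/-! ### The relative entropy function -/

theorem abs_klFun_sub_le {x : ℝ} (hx : |x - 1| ≤ 1 / 2) :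
    |klFun x - (x - 1) ^ 2 / 2| ≤ 4 * |x - 1| ^ 3 := by
  obtain ⟨w, rfl⟩ : ∃ w, x = 1 + w := ⟨x - 1, by ring⟩
  rw [add_sub_cancel_left] at hx ⊢
  have h := Real.abs_log_sub_add_sum_range_le (x := -w) (by rw [abs_neg]; linarith) 2
  rw [abs_neg, sub_neg_eq_add] at h
  norm_num [Finset.sum_range_succ] at h
  have h3 : |w| ^ 3 / (1 - |w|) ≤ 2 * |w| ^ 3 := by
    rw [div_le_iff₀ (by linarith)]
    nlinarith [pow_nonneg (abs_nonneg w) 3]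
  set R := -w + w ^ 2 / 2 + Real.log (1 + w) with hR
  have hk : klFun (1 + w) - w ^ 2 / 2 = -w ^ 3 / 2 + (1 + w) * R := by
    rw [InformationTheory.klFun, hR]; ring
  have h1w : |1 + w| ≤ 3 / 2 := (abs_add_le 1 w).trans (by rw [abs_one]; linarith)
  rw [hk]
  calc |-w ^ 3 / 2 + (1 + w) * R| ≤ |-w ^ 3 / 2| + |1 + w| * |R| := by
        rw [← abs_mul]; exact abs_add_le _ _
    _ ≤ |w| ^ 3 / 2 + 3 / 2 * (2 * |w| ^ 3) := by
        gcongr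
        · rw [abs_div, abs_neg, abs_pow]; norm_num
        · exact h.trans h3
    _ ≤ 4 * |w| ^ 3 := by nlinarith [pow_nonneg (abs_nonneg w) 3]

/-- Hellinger's bound, from `log y ≤ y - 1` at `y = 1 / √x`. -/
theorem sq_sqrt_sub_one_le_klFun {x : ℝ} (hx : 0 ≤ x) : (√x - 1) ^ 2 ≤ klFun x := by
  rcases hx.eq_or_lt with rfl | hx
  · simp [InformationTheory.klFun]
  · have hs : 0 < √x := Real.sqrt_pos.2 hx
    have h1 : Real.log (√x)⁻¹ ≤ (√x)⁻¹ - 1 := Real.log_le_sub_one_of_pos (by positivity)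
    rw [Real.log_inv, Real.log_sqrt hx.le] at h1
    have h2 : x * (√x)⁻¹ = √x := by
      field_simp
      exact (Real.sq_sqrt hx.le).symm
    have h3 := mul_le_mul_of_nonneg_left h1 hx.le
    rw [mul_sub, h2] at h3
    rw [InformationTheory.klFun, sub_sq, Real.sq_sqrt hx.le]
    linarith

theorem sq_sub_one_le_klFun {x b : ℝ} (hx : 0 ≤ x) (hb : x ≤ b) :
    (x - 1) ^ 2 / 2 ≤ (b + 1) * klFun x := by
  have h1 := sq_sqrt_sub_one_le_klFun hx
  have h2 : (x - 1) ^ 2 = (√x - 1) ^ 2 * (√x + 1) ^ 2 := by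
    rw [← mul_pow, show (√x - 1) * (√x + 1) = √x ^ 2 - 1 by ring, Real.sq_sqrt hx]
  have h3 : (√x + 1) ^ 2 ≤ 2 * (b + 1) := by
    nlinarith [sq_nonneg (√x - 1), Real.sq_sqrt hx]
  rw [h2]
  have := mul_le_mul h1 h3 (sq_nonneg _) (InformationTheory.klFun_nonneg hx)
  linarith

/-! ### Stirling's formula -/

/-- The subexponential factor of the factorial. -/
noncomputable def stirlingFactor (n : ℕ) : ℝ := n.factorial / (n / Real.exp 1) ^ n

theorem stirlingFactor_zero : stirlingFactor 0 = 1 := by simp [stirlingFactor]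

theorem stirlingFactor_eq {n : ℕ} (hn : n ≠ 0) :
    stirlingFactor n = Stirling.stirlingSeq n * √(2 * n) := by
  have : (0 : ℝ) < n := by positivity
  rw [stirlingFactor, Stirling.stirlingSeq]
  field_simp

theorem factorial_eq_stirlingFactor (n : ℕ) :
    (n.factorial : ℝ) = stirlingFactor n * (n / Real.exp 1) ^ n := by
  rcases eq_or_ne n 0 with rfl | hn
  · simp [stirlingFactor]
  · rw [stirlingFactor, div_mul_cancel₀]
    have : (0 : ℝ) < n := by positivity
    positivity

/-- The maximum with `1` makes the bound useful for empty cells, where the factor is `1`. -/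
theorem sqrt_max_le_stirlingFactor (n : ℕ) : √(max (n : ℝ) 1) ≤ stirlingFactor n := by
  rcases eq_or_ne n 0 with rfl | hn
  · simp [stirlingFactor_zero]
  · have h1 : (1 : ℝ) ≤ n := by exact_mod_cast Nat.one_le_iff_ne_zero.2 hn
    rw [max_eq_left h1, stirlingFactor_eq hn]
    have h2 := Stirling.sqrt_pi_le_stirlingSeq hn
    have h3 : (1 : ℝ) ≤ √Real.pi := Real.one_le_sqrt.2 (by linarith [Real.pi_gt_three])
    calc √(n : ℝ) = 1 * √(n : ℝ) := (one_mul _).symm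
      _ ≤ Stirling.stirlingSeq n * √(2 * n) := by
        refine mul_le_mul (h3.trans h2) (Real.sqrt_le_sqrt (by linarith)) (Real.sqrt_nonneg _) ?_
        linarith

theorem stirlingFactor_pos (n : ℕ) : 0 < stirlingFactor n :=
  lt_of_lt_of_le (Real.sqrt_pos.2 (lt_max_of_lt_right one_pos)) (sqrt_max_le_stirlingFactor n)

theorem tendsto_stirlingFactor_div_sqrt :
    Tendsto (fun n : ℕ => stirlingFactor n / √(n : ℝ)) atTop (𝓝 √(2 * Real.pi)) := by
  have h := Stirling.tendsto_stirlingSeq_sqrt_pi.mul_const √2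
  rw [← Real.sqrt_mul Real.pi_pos.le, mul_comm Real.pi] at h
  refine h.congr' ?_
  filter_upwards [eventually_ne_atTop 0] with n hn
  have : (0 : ℝ) < √n := Real.sqrt_pos.2 (by positivity)
  rw [stirlingFactor_eq hn, Real.sqrt_mul zero_le_two]
  field_simp

/-! ### The multinomial distribution -/

section Multinomial

variable {ι : Type*} [Fintype ι]

/-- The probability of the vector `a` under the multinomial distribution with `∑ i, a i` trials and
cell probabilities `p`. -/
noncomputable def mass (p : ι → ℝ) (a : ι → ℕ) : ℝ :=
  Nat.multinomial Finset.univ a * ∏ i, p i ^ a i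

/-- The number of trials. -/
def trials (a : ι → ℕ) : ℕ := ∑ i, a i

/-- The ratio of the observed to the expected frequency. -/
noncomputable def ratio (p : ι → ℝ) (a : ι → ℕ) (i : ι) : ℝ := a i / (trials a * p i)

/-- Half of Pearson's statistic. -/
noncomputable def pearson (p : ι → ℝ) (a : ι → ℕ) : ℝ :=
  ∑ i, trials a * p i * ((ratio p a i - 1) ^ 2 / 2)

/-- The scaled relative entropy of the empirical distribution. -/
noncomputable def entropy (p : ι → ℝ) (a : ι → ℕ) : ℝ :=
  ∑ i, trials a * p i * klFun (ratio p a i)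

variable {p : ι → ℝ} {a : ι → ℕ}

/-- The linear terms of `klFun` cancel, since observed and expected counts have the same total. -/
theorem entropy_eq_sum_log (hp : ∀ i, 0 < p i) (hsum : ∑ i, p i = 1) (ha : trials a ≠ 0) :
    entropy p a = ∑ i, a i * Real.log (ratio p a i) := by
  have hN : (0 : ℝ) < trials a := by positivity
  have h : ∀ i, trials a * p i * klFun (ratio p a i) =
      a i * Real.log (ratio p a i) + (trials a * p i - a i) := fun i => by
    have := hp i
    rw [InformationTheory.klFun]
    have hx : trials a * p i * ratio p a i = a i := by rw [ratio]; field_simp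
    linear_combination (Real.log (ratio p a i) - 1) * hx
  rw [entropy, Finset.sum_congr rfl fun i _ => h i, Finset.sum_add_distrib, Finset.sum_sub_distrib,
    ← Finset.mul_sum, hsum, trials]
  push_cast
  ring

theorem entropy_nonneg (hp : ∀ i, 0 < p i) : 0 ≤ entropy p a :=
  Finset.sum_nonneg fun i _ => mul_nonneg (mul_nonneg (Nat.cast_nonneg _) (hp i).le)
    (InformationTheory.klFun_nonneg (div_nonneg (Nat.cast_nonneg _)
      (mul_nonneg (Nat.cast_nonneg _) (hp i).le)))

theorem prod_pow_eq_exp_entropy (hp : ∀ i, 0 < p i) (hsum : ∑ i, p i = 1) (ha : trials a ≠ 0) :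
    ∏ i, (trials a * p i) ^ a i = (∏ i, (a i : ℝ) ^ a i) * Real.exp (-entropy p a) := by
  have hN : (0 : ℝ) < trials a := by positivity
  rw [entropy_eq_sum_log hp hsum ha, ← Finset.sum_neg_distrib, Real.exp_sum,
    ← Finset.prod_mul_distrib]
  refine Finset.prod_congr rfl fun i _ => ?_
  rcases eq_or_ne (a i) 0 with h | h
  · simp [h]
  · have := hp i
    have hx : 0 < ratio p a i := by rw [ratio]; positivity
    rw [← mul_neg, Real.exp_nat_mul, Real.exp_neg, Real.exp_log hx, ← mul_pow, ratio]
    congr 1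
    field_simp

/-- Stirling's formula for the multinomial distribution, without error term. -/
theorem mass_eq (hp : ∀ i, 0 < p i) (hsum : ∑ i, p i = 1) (ha : trials a ≠ 0) :
    mass p a = stirlingFactor (trials a) / (∏ i, stirlingFactor (a i)) *
      Real.exp (-entropy p a) := by
  have hN : (0 : ℝ) < trials a := by positivity
  have hs : 0 < ∏ i, stirlingFactor (a i) := Finset.prod_pos fun i _ => stirlingFactor_pos _
  have hm : (∏ i, ((a i).factorial : ℝ)) * Nat.multinomial Finset.univ a = (trials a).factorial := by
    exact_mod_cast Nat.multinomial_spec Finset.univ a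
  have hf : ∏ i, ((a i).factorial : ℝ) =
      (∏ i, stirlingFactor (a i)) * ((∏ i, (a i : ℝ) ^ a i) / Real.exp 1 ^ trials a) := by
    rw [trials, ← Finset.prod_pow_eq_pow_sum, ← Finset.prod_div_distrib, ← Finset.prod_mul_distrib]
    exact Finset.prod_congr rfl fun i _ => by rw [factorial_eq_stirlingFactor, div_pow]
  have ha' : 0 < ∏ i, (a i : ℝ) ^ a i := Finset.prod_pos fun i _ => by
    rcases eq_or_ne (a i) 0 with h | h
    · simp [h]
    · positivity
  have hk := prod_pow_eq_exp_entropy hp hsum ha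
  simp_rw [mul_pow] at hk
  rw [Finset.prod_mul_distrib, Finset.prod_pow_eq_pow_sum, ← trials] at hk
  rw [factorial_eq_stirlingFactor, hf, div_pow] at hm
  rw [mass, div_mul_eq_mul_div, eq_div_iff hs.ne']
  have he : 0 < Real.exp 1 ^ trials a := by positivity
  field_simp at hm
  refine mul_left_cancel₀ ha'.ne' ?_
  calc (∏ i, (a i : ℝ) ^ a i) * (Nat.multinomial Finset.univ a * (∏ i, p i ^ a i) *
        ∏ i, stirlingFactor (a i))
      = stirlingFactor (trials a) * (trials a ^ trials a * ∏ i, p i ^ a i) := by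
        linear_combination (∏ i, p i ^ a i) * hm
    _ = _ := by rw [hk]; ring

theorem pearson_nonneg (hp : ∀ i, 0 < p i) : 0 ≤ pearson p a :=
  Finset.sum_nonneg fun i _ => mul_nonneg (mul_nonneg (Nat.cast_nonneg _) (hp i).le) (by positivity)

theorem term_le_pearson (hp : ∀ i, 0 < p i) (i : ι) :
    trials a * p i * ((ratio p a i - 1) ^ 2 / 2) ≤ pearson p a :=
  Finset.single_le_sum (f := fun i => trials a * p i * ((ratio p a i - 1) ^ 2 / 2))
    (fun i _ => mul_nonneg (mul_nonneg (Nat.cast_nonneg _) (hp i).le) (by positivity))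
    (Finset.mem_univ i)

theorem ratio_nonneg (hp : ∀ i, 0 < p i) (i : ι) : 0 ≤ ratio p a i :=
  div_nonneg (Nat.cast_nonneg _) (mul_nonneg (Nat.cast_nonneg _) (hp i).le)

theorem ratio_le (hp : ∀ i, 0 < p i) (ha : trials a ≠ 0) (i : ι) : ratio p a i ≤ (p i)⁻¹ := by
  have hN : (0 : ℝ) < trials a := by positivity
  have := hp i
  have hle : (a i : ℝ) ≤ trials a := by
    exact_mod_cast Finset.single_le_sum (f := a) (fun _ _ => Nat.zero_le _) (Finset.mem_univ i)
  rw [ratio, div_le_iff₀ (by positivity)]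
  field_simp
  exact hle

/-- No count exceeds `N`, so the ratios are at most `1 / p i`, and on a bounded range `klFun`
dominates a multiple of the square. -/
theorem pearson_le_entropy (hp : ∀ i, 0 < p i) (ha : trials a ≠ 0) :
    pearson p a ≤ (∑ i, ((p i)⁻¹ + 1)) * entropy p a := by
  rw [entropy, Finset.mul_sum, pearson]
  refine Finset.sum_le_sum fun i _ => ?_
  have h1 := sq_sub_one_le_klFun (ratio_nonneg (a := a) hp i) (ratio_le hp ha i)
  have h2 : (p i)⁻¹ + 1 ≤ ∑ i, ((p i)⁻¹ + 1) :=
    Finset.single_le_sum (f := fun i => (p i)⁻¹ + 1)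
      (fun i _ => by have := hp i; positivity) (Finset.mem_univ i)
  have h3 := InformationTheory.klFun_nonneg (ratio_nonneg (a := a) hp i)
  have h4 : 0 ≤ trials a * p i := mul_nonneg (Nat.cast_nonneg _) (hp i).le
  calc trials a * p i * ((ratio p a i - 1) ^ 2 / 2)
      ≤ trials a * p i * (((p i)⁻¹ + 1) * klFun (ratio p a i)) := by gcongr
    _ ≤ trials a * p i * ((∑ i, ((p i)⁻¹ + 1)) * klFun (ratio p a i)) := by gcongr
    _ = _ := by ring

/-- Either the cell holds at least half its expected count, or its deviation alone forces `pearson`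
to be at least `N p i / 8`. -/
theorem trials_div_max_le (hp : ∀ i, 0 < p i) (ha : trials a ≠ 0) (i : ι) :
    trials a / max (a i : ℝ) 1 ≤ (2 + 8 * pearson p a) / p i := by
  have hN : (0 : ℝ) < trials a := by positivity
  have hpi := hp i
  have ht := term_le_pearson (a := a) hp i
  have h0 := pearson_nonneg (a := a) hp
  have hx : trials a * p i * ratio p a i = a i := by rw [ratio]; field_simp
  rw [div_le_div_iff₀ (by positivity) hpi]
  rcases le_or_gt (1 / 2) (ratio p a i) with h | h
  · calc (trials a : ℝ) * p i ≤ 2 * (trials a * p i * ratio p a i) := by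
          nlinarith [mul_pos hN hpi]
      _ = 2 * a i := by rw [hx]
      _ ≤ (2 + 8 * pearson p a) * max (a i : ℝ) 1 := by
        gcongr
        · linarith
        · exact le_max_left _ _
  · have h1 : 1 / 8 ≤ (ratio p a i - 1) ^ 2 / 2 := by nlinarith
    have h2 : trials a * p i * (1 / 8) ≤ pearson p a :=
      (mul_le_mul_of_nonneg_left h1 (by positivity)).trans ht
    calc (trials a : ℝ) * p i ≤ (2 + 8 * pearson p a) * 1 := by linarith
      _ ≤ (2 + 8 * pearson p a) * max (a i : ℝ) 1 := by
        gcongr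
        exact le_max_right _ _

theorem sqrt_div_stirlingFactor_le (hp : ∀ i, 0 < p i) (hsum : ∑ i, p i = 1) (ha : trials a ≠ 0)
    (i : ι) : √(trials a : ℝ) / stirlingFactor (a i) ≤ (2 + 8 * pearson p a) / p i := by
  have hpi := hp i
  have h0 := pearson_nonneg (a := a) hp
  have hp1 : p i ≤ 1 := hsum ▸ Finset.single_le_sum (fun i _ => (hp i).le) (Finset.mem_univ i)
  have h1 : 1 ≤ (2 + 8 * pearson p a) / p i := by rw [le_div_iff₀ hpi]; linarith
  calc √(trials a : ℝ) / stirlingFactor (a i) ≤ √(trials a : ℝ) / √(max (a i : ℝ) 1) := by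
        gcongr
        · exact sqrt_max_le_stirlingFactor _
    _ = √(trials a / max (a i : ℝ) 1) := (Real.sqrt_div (Nat.cast_nonneg _) _).symm
    _ ≤ √(((2 + 8 * pearson p a) / p i) ^ 2) := by
        refine Real.sqrt_le_sqrt ((trials_div_max_le hp ha i).trans ?_)
        nlinarith
    _ = _ := Real.sqrt_sq (by linarith)

end Multinomial

/-! ### The multinomial local limit theorem -/

section MultinomialLimit

variable {d : ℕ} {p : Fin (d + 1) → ℝ} {l : Filter (Fin (d + 1) → ℕ)}

/-- The constant in the multinomial local limit theorem. -/
noncomputable def peak (p : Fin (d + 1) → ℝ) : ℝ :=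
  √(2 * Real.pi) / ∏ i, (√(2 * Real.pi) * √(p i))

theorem sqrt_pow_mul_mass_eq {a : Fin (d + 1) → ℕ} (hp : ∀ i, 0 < p i) (hsum : ∑ i, p i = 1)
    (ha : trials a ≠ 0) :
    √(trials a : ℝ) ^ d * mass p a = stirlingFactor (trials a) / √(trials a : ℝ) *
      (∏ i, √(trials a : ℝ) / stirlingFactor (a i)) * Real.exp (-entropy p a) := by
  have hN : 0 < √(trials a : ℝ) := Real.sqrt_pos.2 (by positivity)
  have hs : 0 < ∏ i, stirlingFactor (a i) := Finset.prod_pos fun i _ => stirlingFactor_pos _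
  rw [mass_eq hp hsum ha, Finset.prod_div_distrib, Finset.prod_const, Finset.card_univ,
    Fintype.card_fin, pow_succ]
  field_simp

/-- The prefactor is at most of degree `d + 1` in `pearson`, while the exponential decays at least
like `exp (-pearson / b)`. -/
theorem tendsto_sqrt_pow_mul_mass_zero (hp : ∀ i, 0 < p i) (hsum : ∑ i, p i = 1)
    (hN : Tendsto trials l atTop) (hT : Tendsto (pearson p) l atTop) :
    Tendsto (fun a => √(trials a : ℝ) ^ d * mass p a) l (𝓝 0) := by
  set b := ∑ i, ((p i)⁻¹ + 1) with hb
  have hbpos : 0 < b := Finset.sum_pos (fun i _ => by have := hp i; positivity)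
    ⟨0, Finset.mem_univ 0⟩
  have hne : ∀ᶠ a in l, trials a ≠ 0 := hN.eventually_ne_atTop 0
  have hlim : Tendsto (fun a => (√(2 * Real.pi) + 1) * ((∏ i, (p i)⁻¹) * ((10 * b) ^ (d + 1) *
      ((pearson p a / b) ^ (d + 1) * Real.exp (-(pearson p a / b)))))) l (𝓝 0) := by
    have h := (Real.tendsto_pow_mul_exp_neg_atTop_nhds_zero (d + 1)).comp
      (hT.atTop_div_const hbpos)
    simpa using ((h.const_mul ((10 * b) ^ (d + 1))).const_mul (∏ i, (p i)⁻¹)).const_mul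
      (√(2 * Real.pi) + 1)
  have hst : ∀ᶠ a in l, stirlingFactor (trials a) / √(trials a : ℝ) ≤ √(2 * Real.pi) + 1 :=
    ((tendsto_stirlingFactor_div_sqrt.comp hN).eventually_lt_const (lt_add_one _)).mono
      fun _ h => h.le
  refine squeeze_zero' ?_ ?_ hlim
  · refine Eventually.of_forall fun a => mul_nonneg (by positivity) (mul_nonneg (by positivity) ?_)
    exact Finset.prod_nonneg fun i _ => pow_nonneg (hp i).le _
  · filter_upwards [hne, hst, hT.eventually_ge_atTop 1] with a ha hs h1
    rw [sqrt_pow_mul_mass_eq hp hsum ha, mul_assoc]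
    -- Once `pearson ≥ 1`, the bound `2 + 8 * pearson` is at most `10 * pearson`.
    have hprod : ∏ i, √(trials a : ℝ) / stirlingFactor (a i) ≤
        (∏ i, (p i)⁻¹) * (10 * pearson p a) ^ (d + 1) := by
      have : (∏ i, (p i)⁻¹) * (10 * pearson p a) ^ (d + 1) =
          ∏ i, ((10 * pearson p a) * (p i)⁻¹) := by
        rw [Finset.prod_mul_distrib, Finset.prod_const, Finset.card_univ, Fintype.card_fin,
          mul_comm]
      rw [this]
      refine Finset.prod_le_prod (fun i _ => div_nonneg (Real.sqrt_nonneg _)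
        (stirlingFactor_pos _).le) fun i _ => ?_
      refine (sqrt_div_stirlingFactor_le hp hsum ha i).trans ?_
      have := hp i
      rw [div_eq_mul_inv]
      gcongr
      linarith
    have hexp : Real.exp (-entropy p a) ≤ Real.exp (-(pearson p a / b)) := by
      rw [Real.exp_le_exp, neg_le_neg_iff, div_le_iff₀ hbpos, mul_comm]
      exact pearson_le_entropy hp ha
    have hpi : 0 ≤ ∏ i, (p i)⁻¹ := Finset.prod_nonneg fun i _ => (inv_pos.2 (hp i)).le
    have heq : (10 * b) ^ (d + 1) * ((pearson p a / b) ^ (d + 1) * Real.exp (-(pearson p a / b))) =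
        (10 * pearson p a) ^ (d + 1) * Real.exp (-(pearson p a / b)) := by
      rw [← mul_assoc, ← mul_pow]
      congr 2
      field_simp
    rw [heq, ← mul_assoc (∏ i, (p i)⁻¹)]
    refine mul_le_mul hs (mul_le_mul hprod hexp (Real.exp_pos _).le ?_) (mul_nonneg
      (Finset.prod_nonneg fun i _ => div_nonneg (Real.sqrt_nonneg _) (stirlingFactor_pos _).le)
      (Real.exp_pos _).le) (by positivity)
    positivity

theorem tendsto_ratio (hp : ∀ i, 0 < p i) (hN : Tendsto trials l atTop) {K : ℝ}
    (hT : ∀ᶠ a in l, pearson p a ≤ K) (i : Fin (d + 1)) :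
    Tendsto (fun a => ratio p a i) l (𝓝 1) := by
  have hpi := hp i
  have hNR : Tendsto (fun a => (trials a : ℝ)) l atTop := tendsto_natCast_atTop_atTop.comp hN
  have h1 : Tendsto (fun a => √(2 * K / p i / trials a)) l (𝓝 0) := by
    have := (hNR.const_div_atTop (2 * K / p i)).sqrt
    simpa using this
  rw [tendsto_iff_norm_sub_tendsto_zero]
  refine squeeze_zero' (Eventually.of_forall fun a => norm_nonneg _) ?_ h1
  filter_upwards [hT, hN.eventually_ne_atTop 0] with a ha hne
  have hN : (0 : ℝ) < trials a := by positivity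
  have := (term_le_pearson (a := a) hp i).trans ha
  rw [Real.norm_eq_abs]
  refine Real.abs_le_sqrt ?_
  rw [div_div, le_div_iff₀ (by positivity)]
  linarith

theorem abs_entropy_sub_pearson_le {a : Fin (d + 1) → ℕ} (hp : ∀ i, 0 < p i)
    (h : ∀ i, |ratio p a i - 1| ≤ 1 / 2) :
    |entropy p a - pearson p a| ≤ pearson p a * ∑ i, 8 * |ratio p a i - 1| := by
  rw [entropy, pearson, ← Finset.sum_sub_distrib, ← pearson, Finset.mul_sum]
  refine (Finset.abs_sum_le_sum_abs _ _).trans (Finset.sum_le_sum fun i _ => ?_)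
  have h4 : 0 ≤ trials a * p i := mul_nonneg (Nat.cast_nonneg _) (hp i).le
  rw [← mul_sub, abs_mul, abs_of_nonneg h4]
  calc trials a * p i * |klFun (ratio p a i) - (ratio p a i - 1) ^ 2 / 2|
      ≤ trials a * p i * (4 * |ratio p a i - 1| ^ 3) := by
        gcongr
        exact abs_klFun_sub_le (h i)
    _ = trials a * p i * ((ratio p a i - 1) ^ 2 / 2) * (8 * |ratio p a i - 1|) := by
        rw [← sq_abs (ratio p a i - 1)]; ring
    _ ≤ _ := by
        gcongr
        exact term_le_pearson hp i

theorem tendsto_entropy_sub_pearson (hp : ∀ i, 0 < p i) (hN : Tendsto trials l atTop) {K : ℝ}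
    (hT : ∀ᶠ a in l, pearson p a ≤ K) :
    Tendsto (fun a => entropy p a - pearson p a) l (𝓝 0) := by
  have h0 : ∀ i, Tendsto (fun a => |ratio p a i - 1|) l (𝓝 0) := fun i => by
    simpa using ((tendsto_ratio hp hN hT i).sub_const 1).abs
  have hlim : Tendsto (fun a => K * ∑ i, 8 * |ratio p a i - 1|) l (𝓝 0) := by
    simpa using (tendsto_finsetSum Finset.univ fun i _ => (h0 i).const_mul 8).const_mul K
  refine squeeze_zero_norm' ?_ hlim
  have hall : ∀ᶠ a in l, ∀ i, |ratio p a i - 1| ≤ 1 / 2 :=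
    eventually_all.2 fun i => (h0 i).eventually_le_const (by norm_num)
  filter_upwards [hT, hall] with a ha h
  rw [Real.norm_eq_abs]
  refine (abs_entropy_sub_pearson_le hp h).trans ?_
  gcongr

theorem tendsto_sqrt_pow_mul_mass_sub (hp : ∀ i, 0 < p i) (hsum : ∑ i, p i = 1)
    (hN : Tendsto trials l atTop) {K : ℝ} (hT : ∀ᶠ a in l, pearson p a ≤ K) :
    Tendsto (fun a => √(trials a : ℝ) ^ d * mass p a - peak p * Real.exp (-pearson p a)) l
      (𝓝 0) := by
  have hNR : Tendsto (fun a => (trials a : ℝ)) l atTop := tendsto_natCast_atTop_atTop.comp hN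
  have hpi2 : 0 < √(2 * Real.pi) := Real.sqrt_pos.2 (by positivity)
  have hfac : ∀ i, Tendsto (fun a => √(trials a : ℝ) / stirlingFactor (a i)) l
      (𝓝 (√(2 * Real.pi) * √(p i))⁻¹) := fun i => by
    have hpi := hp i
    have hr := tendsto_ratio hp hN hT i
    have hai : Tendsto (fun a : Fin (d + 1) → ℕ => a i) l atTop := by
      rw [← tendsto_natCast_atTop_iff (R := ℝ)]
      have := (hNR.atTop_mul_const hpi).atTop_mul_pos one_pos hr
      refine this.congr' ?_
      filter_upwards [hN.eventually_ne_atTop 0] with a ha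
      have : (0 : ℝ) < trials a := by positivity
      rw [ratio]; field_simp
    have h := ((tendsto_stirlingFactor_div_sqrt.comp hai).mul (hr.sqrt.mul_const √(p i))).inv₀
      (mul_ne_zero hpi2.ne' (mul_ne_zero (by simp) (Real.sqrt_pos.2 hpi).ne'))
    simp only [Real.sqrt_one, one_mul] at h
    refine h.congr' ?_
    filter_upwards [hN.eventually_ne_atTop 0, hai.eventually_ne_atTop 0] with a ha hb
    have h1 : 0 < √(trials a : ℝ) := Real.sqrt_pos.2 (by positivity)
    have h2 : 0 < √(a i : ℝ) := Real.sqrt_pos.2 (by positivity)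
    have h3 := Real.sqrt_pos.2 hpi
    have h4 := stirlingFactor_pos (a i)
    simp only [Function.comp, ratio]
    rw [Real.sqrt_div (Nat.cast_nonneg _), Real.sqrt_mul (Nat.cast_nonneg _)]
    field_simp
  have hpre : Tendsto (fun a => stirlingFactor (trials a) / √(trials a : ℝ) *
      ∏ i, √(trials a : ℝ) / stirlingFactor (a i)) l (𝓝 (peak p)) := by
    have := (tendsto_stirlingFactor_div_sqrt.comp hN).mul
      (tendsto_finsetProd Finset.univ fun i _ => hfac i)
    rw [Finset.prod_inv_distrib, ← div_eq_mul_inv] at this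
    exact this
  have hexp : Tendsto (fun a => Real.exp (-(entropy p a - pearson p a)) - 1) l (𝓝 0) := by
    have := (((tendsto_entropy_sub_pearson hp hN hT).neg).rexp).sub_const 1
    simpa using this
  have hb1 : IsBoundedUnder (· ≤ ·) l (norm ∘ fun a => Real.exp (-entropy p a)) :=
    isBoundedUnder_of ⟨1, fun a => by
      simpa [abs_of_pos (Real.exp_pos _)] using entropy_nonneg hp⟩
  have hb2 : IsBoundedUnder (· ≤ ·) l (norm ∘ fun a => peak p * Real.exp (-pearson p a)) :=
    isBoundedUnder_of ⟨|peak p|, fun a => by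
      have : Real.exp (-pearson p a) ≤ 1 := by simpa using pearson_nonneg hp
      simp only [Function.comp, norm_mul, Real.norm_eq_abs, abs_of_pos (Real.exp_pos _)]
      nlinarith [abs_nonneg (peak p)]⟩
  -- The prefactor is replaced by its limit first, then entropy by `pearson`; each error is a null
  -- function times a bounded one.
  have hpre0 := hpre.sub_const (peak p)
  rw [sub_self] at hpre0
  have h1 := hpre0.zero_mul_isBoundedUnder_le hb1
  have h2 := hexp.zero_mul_isBoundedUnder_le hb2
  have h := h1.add h2
  rw [add_zero] at h
  refine h.congr' ?_
  filter_upwards [hN.eventually_ne_atTop 0] with a ha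
  rw [sqrt_pow_mul_mass_eq hp hsum ha]
  have : Real.exp (-entropy p a) =
      Real.exp (-(entropy p a - pearson p a)) * Real.exp (-pearson p a) := by
    rw [← Real.exp_add]; congr 1; ring
  rw [this]; ring

end MultinomialLimit

/-! ### Passage from the number of parts to the size -/

section WeightLimit

variable {d : ℕ} {p : Fin (d + 1) → ℝ} {l : Filter (Fin (d + 1) → ℕ)}

/-- The size of the composition with multiplicities `a`. -/
def weight (a : Fin (d + 1) → ℕ) : ℕ := ∑ i : Fin (d + 1), ((i : ℕ) + 1) * a i

/-- The mean of the distribution with `ℙ(i + 1) = p i`. -/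
noncomputable def mean (p : Fin (d + 1) → ℝ) : ℝ := ∑ i : Fin (d + 1), ((i : ℝ) + 1) * p i

theorem trials_le_weight (a : Fin (d + 1) → ℕ) : trials a ≤ weight a :=
  Finset.sum_le_sum fun _ _ => Nat.le_mul_of_pos_left _ (Nat.succ_pos _)

theorem weight_le_mul_trials (a : Fin (d + 1) → ℕ) : weight a ≤ (d + 1) * trials a := by
  rw [trials, Finset.mul_sum]
  exact Finset.sum_le_sum fun i _ => Nat.mul_le_mul_right _ i.isLt

theorem mean_pos (hp : ∀ i, 0 < p i) : 0 < mean p :=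
  Finset.sum_pos (fun i _ => mul_pos (by positivity) (hp i)) ⟨0, Finset.mem_univ 0⟩

theorem tendsto_weight_div_trials (hp : ∀ i, 0 < p i) (hN : Tendsto trials l atTop) {K : ℝ}
    (hT : ∀ᶠ a in l, pearson p a ≤ K) :
    Tendsto (fun a => (weight a : ℝ) / trials a) l (𝓝 (mean p)) := by
  have h := tendsto_finsetSum Finset.univ fun (i : Fin (d + 1)) _ =>
    (tendsto_ratio hp hN hT i).const_mul (((i : ℝ) + 1) * p i)
  simp only [mul_one] at h
  refine h.congr' ?_
  filter_upwards [hN.eventually_ne_atTop 0] with a ha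
  have hpos : (0 : ℝ) < trials a := by positivity
  rw [weight]
  push_cast
  rw [Finset.sum_div]
  refine Finset.sum_congr rfl fun i _ => ?_
  have := hp i
  rw [ratio]
  field_simp

/-- The factor `mean p * trials a / weight a` tends to `1` where `pearson` is bounded. It is kept
because it makes the exponent equal to that of `v`. In the tails it stays above `mean p / (d + 1)`,
so the exponent still diverges. -/
theorem tendsto_sqrt_weight_pow_mul_mass_sub (hp : ∀ i, 0 < p i) (hsum : ∑ i, p i = 1)
    (hN : Tendsto trials l atTop) :
    Tendsto (fun a => √(weight a : ℝ) ^ d * mass p a -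
      peak p * √(mean p) ^ d * Real.exp (-(mean p * trials a / weight a * pearson p a))) l
      (𝓝 0) := by
  have hμ := mean_pos hp
  have hsqrt : ∀ a : Fin (d + 1) → ℕ, trials a ≠ 0 →
      √(weight a : ℝ) ^ d = √((weight a : ℝ) / trials a) ^ d * √(trials a : ℝ) ^ d := by
    intro a ha
    have hpos : (0 : ℝ) < trials a := by positivity
    rw [← mul_pow, ← Real.sqrt_mul (by positivity), div_mul_cancel₀ _ hpos.ne']
  refine tendsto_of_le_or_tendsto_atTop (T := pearson p) ?_ ?_
  · intro l' hl K hT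
    have hN' := hN.mono_left hl
    have hr := tendsto_weight_div_trials hp hN' hT
    have hr1 : Tendsto (fun a => mean p * trials a / weight a - 1) l' (𝓝 0) := by
      have := (hr.inv₀ hμ.ne').const_mul (mean p)
      rw [mul_inv_cancel₀ hμ.ne'] at this
      have := this.sub_const 1
      rw [sub_self] at this
      refine this.congr fun a => ?_
      rw [inv_div, mul_div_assoc]
    have hrp := hr.sqrt.pow d
    have hbT : IsBoundedUnder (· ≤ ·) l' (norm ∘ fun a => pearson p a) :=
      isBoundedUnder_of_eventually_le (a := K) (hT.mono fun a ha => by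
        simpa [abs_of_nonneg (pearson_nonneg (a := a) hp)] using ha)
    have hbe : IsBoundedUnder (· ≤ ·) l' (norm ∘ fun a => Real.exp (-pearson p a)) :=
      isBoundedUnder_of ⟨1, fun a => by
        simpa [abs_of_pos (Real.exp_pos _)] using pearson_nonneg hp⟩
    -- The three terms replace in turn the mass, the power of `weight / trials` and the exponent.
    have h1 := hrp.mul (tendsto_sqrt_pow_mul_mass_sub hp hsum hN' hT)
    have hrp0 := hrp.sub_const (√(mean p) ^ d)
    rw [sub_self] at hrp0
    have h2 := (hrp0.zero_mul_isBoundedUnder_le hbe).const_mul (peak p)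
    have hT0 := hr1.zero_mul_isBoundedUnder_le hbT
    have hT1 := hT0.neg.rexp.const_sub 1
    rw [neg_zero, Real.exp_zero, sub_self] at hT1
    have h3 := (hT1.zero_mul_isBoundedUnder_le hbe).const_mul (peak p * √(mean p) ^ d)
    have h := (h1.add h2).add h3
    simp only [mul_zero, add_zero] at h
    refine h.congr' ?_
    filter_upwards [hN'.eventually_ne_atTop 0] with a ha
    have he : Real.exp (-(mean p * trials a / weight a * pearson p a)) =
        Real.exp (-((mean p * trials a / weight a - 1) * pearson p a)) *
          Real.exp (-pearson p a) := by
      rw [← Real.exp_add]; congr 1; ring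
    rw [he, hsqrt a ha]
    ring
  · intro l' hl hT
    have hN' := hN.mono_left hl
    have hle : ∀ a : Fin (d + 1) → ℕ, trials a ≠ 0 → (weight a : ℝ) / trials a ≤ d + 1 := by
      intro a ha
      have hpos : (0 : ℝ) < trials a := by positivity
      rw [div_le_iff₀ hpos]
      exact_mod_cast weight_le_mul_trials a
    have hb : IsBoundedUnder (· ≤ ·) l'
        (norm ∘ fun a => √((weight a : ℝ) / trials a) ^ d) := by
      refine isBoundedUnder_of_eventually_le (a := √((d : ℝ) + 1) ^ d) ?_
      filter_upwards [hN'.eventually_ne_atTop 0] with a ha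
      simp only [Function.comp, norm_pow, Real.norm_eq_abs, abs_of_nonneg (Real.sqrt_nonneg _)]
      gcongr
      exact hle a ha
    have h1 := isBoundedUnder_le_mul_tendsto_zero hb
      (tendsto_sqrt_pow_mul_mass_zero hp hsum hN' hT)
    have h2 : Tendsto (fun a => mean p * trials a / weight a * pearson p a) l' atTop := by
      refine tendsto_atTop_mono' l' ?_ (hT.const_mul_atTop (show 0 < mean p / (d + 1) by positivity))
      filter_upwards [hN'.eventually_ne_atTop 0] with a ha
      have hpos : (0 : ℝ) < trials a := by positivity
      have hw : (0 : ℝ) < weight a := hpos.trans_le (by exact_mod_cast trials_le_weight a)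
      refine mul_le_mul_of_nonneg_right ?_ (pearson_nonneg hp)
      have := hle a ha
      rw [div_le_iff₀ hpos] at this
      rw [div_le_div_iff₀ (by positivity) hw]
      nlinarith
    have h3 := (Real.tendsto_exp_neg_atTop_nhds_zero.comp h2).const_mul (peak p * √(mean p) ^ d)
    have h := h1.sub h3
    rw [mul_zero, sub_zero] at h
    refine h.congr' ?_
    filter_upwards [hN'.eventually_ne_atTop 0] with a ha
    rw [hsqrt a ha, Function.comp_apply]
    ring

end WeightLimit

/-! ### The smallest positive root -/

theorem eval_h (d : ℕ) (t : ℝ) : (h d).eval t = 1 - ∑ i : Fin (d + 1), t ^ ((i : ℕ) + 1) := by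
  simp [h, Polynomial.eval_finsetSum, Finset.sum_range]

/-- A root lies in `(0, 1]` because `h(0) = 1` and `h(1) = -d`; it is least because `h` decreases
strictly on the positive axis. -/
theorem exists_isLeast_root (d : ℕ) :
    ∃ ρ : ℝ, IsLeast {t : ℝ | 0 < t ∧ (h d).eval t = 0} ρ := by
  have hcont : ContinuousOn (fun t : ℝ => (h d).eval t) (Set.Icc 0 1) :=
    (h d).continuous.continuousOn
  have h0 : (h d).eval 0 = 1 := by simp [eval_h]
  have h1 : (h d).eval 1 ≤ 0 := by simp [eval_h]
  obtain ⟨ρ, hρ, hroot⟩ := intermediate_value_Icc' zero_le_one hcont ⟨h1, by rw [h0]; exact zero_le_one⟩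
  have hroot' : (h d).eval ρ = 0 := hroot
  have hpos : 0 < ρ := lt_of_le_of_ne hρ.1 fun h => by
    rw [← h, h0] at hroot'
    exact one_ne_zero hroot'
  refine ⟨ρ, ⟨hpos, hroot'⟩, fun t ht => ?_⟩
  by_contra! hlt
  have : ∑ i : Fin (d + 1), t ^ ((i : ℕ) + 1) < ∑ i : Fin (d + 1), ρ ^ ((i : ℕ) + 1) :=
    Finset.sum_lt_sum_of_nonempty ⟨0, Finset.mem_univ 0⟩ fun i _ =>
      pow_lt_pow_left₀ hlt ht.1.le (Nat.succ_ne_zero _)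
  have h2 := ht.2
  rw [eval_h] at h2 hroot'
  linarith

/-- The part sizes of a random composition have the distribution `ℙ(i + 1) = ρ ^ (i + 1)`. -/
noncomputable def prob (d : ℕ) (ρ : ℝ) (i : Fin (d + 1)) : ℝ := ρ ^ ((i : ℕ) + 1)

/-- The second moment of `prob d ρ`. -/
noncomputable def secondMoment (d : ℕ) (ρ : ℝ) : ℝ :=
  ∑ i : Fin (d + 1), ((i : ℝ) + 1) ^ 2 * prob d ρ i

variable {d : ℕ} {ρ : ℝ}

theorem prob_pos (hρ : 0 < ρ) (i : Fin (d + 1)) : 0 < prob d ρ i := pow_pos hρ _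

theorem sum_prob (hroot : (h d).eval ρ = 0) : ∑ i, prob d ρ i = 1 := by
  rw [eval_h] at hroot
  simp only [prob]
  linarith

theorem mul_h1 : ρ * h1 d ρ = -mean (prob d ρ) := by
  simp only [h1, h, mean, prob, Polynomial.derivative_sub, Polynomial.derivative_one,
    Polynomial.derivative_sum, Polynomial.derivative_X_pow, Polynomial.eval_neg,
    Polynomial.eval_finsetSum, Finset.sum_range, zero_sub]
  rw [mul_neg, Finset.mul_sum]
  congr 1
  refine Finset.sum_congr rfl fun i _ => ?_
  simp
  ring

theorem sq_mul_h2 : ρ ^ 2 * h2 d ρ = mean (prob d ρ) - secondMoment d ρ := by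
  simp only [h2, h, mean, prob, secondMoment, Polynomial.derivative_sub, Polynomial.derivative_one,
    Polynomial.derivative_sum, Polynomial.derivative_X_pow,
    Polynomial.eval_finsetSum, Finset.sum_range, zero_sub, mul_neg, Polynomial.derivative_neg,
    Polynomial.eval_neg]
  rw [Finset.mul_sum, ← Finset.sum_sub_distrib, ← Finset.sum_neg_distrib]
  refine Finset.sum_congr rfl fun i _ => ?_
  rcases hi : (i : ℕ) with _ | k
  · simp
  · simp
    ring

theorem h1_eq (hρ : 0 < ρ) : h1 d ρ = -mean (prob d ρ) / ρ := by
  rw [eq_div_iff hρ.ne', mul_comm, mul_h1]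

theorem h2_eq (hρ : 0 < ρ) : h2 d ρ = (mean (prob d ρ) - secondMoment d ρ) / ρ ^ 2 := by
  rw [eq_div_iff (by positivity), mul_comm, sq_mul_h2]

/-! ### The inverse covariance matrix -/

theorem hess_apply (hρ : 0 < ρ) (k l : Fin d) :
    hess d ρ k l = ρ ^ ((k : ℕ) + 2) * ρ ^ ((l : ℕ) + 2) *
        (secondMoment d ρ / mean (prob d ρ) ^ 3 - (k + l + 4) / mean (prob d ρ) ^ 2) +
      if k = l then ρ ^ ((k : ℕ) + 2) / mean (prob d ρ) else 0 := by
  have hμ := mean_pos (prob_pos (d := d) hρ)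
  simp only [hess, Matrix.of_apply, hessEntry, h1_eq hρ, h2_eq hρ]
  by_cases hkl : k = l
  · subst hkl
    simp only [if_true]
    push_cast
    field_simp
    ring
  · have : ¬ (k : ℕ) + 1 = (l : ℕ) + 1 := fun h => hkl (Fin.ext (by omega))
    simp only [if_neg this, if_neg hkl]
    push_cast
    field_simp
    ring

/-- The inverse of the covariance matrix. -/
noncomputable def precision (d : ℕ) (ρ : ℝ) : Matrix (Fin d) (Fin d) ℝ :=
  Matrix.of fun k l => mean (prob d ρ) *
    ((if k = l then 1 / ρ ^ ((k : ℕ) + 2) else 0) + (k + 2) * (l + 2) / ρ - (k + 1) * (l + 1))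

theorem sum_tail_prob (hroot : (h d).eval ρ = 0) : ∑ k : Fin d, ρ ^ ((k : ℕ) + 2) = 1 - ρ := by
  have := sum_prob hroot
  rw [Fin.sum_univ_succ] at this
  simp only [prob, Fin.val_zero, Fin.val_succ, zero_add, pow_one] at this
  linarith

theorem sum_tail_mean : ∑ k : Fin d, ((k : ℝ) + 2) * ρ ^ ((k : ℕ) + 2) =
    mean (prob d ρ) - ρ := by
  rw [mean, Fin.sum_univ_succ]
  simp only [prob, Fin.val_zero, Fin.val_succ]
  push_cast
  rw [zero_add, pow_one, one_mul, add_sub_cancel_left]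
  exact Finset.sum_congr rfl fun k _ => by ring

theorem sum_tail_secondMoment : ∑ k : Fin d, ((k : ℝ) + 2) ^ 2 * ρ ^ ((k : ℕ) + 2) =
    secondMoment d ρ - ρ := by
  rw [secondMoment, Fin.sum_univ_succ]
  simp only [prob, Fin.val_zero, Fin.val_succ]
  push_cast
  rw [zero_add, pow_one, one_pow, one_mul, add_sub_cancel_left]
  exact Finset.sum_congr rfl fun k _ => by ring

/-- Both matrices are diagonal plus finite rank with entries affine in the part sizes, so the
product needs only the moments of orders `0`, `1` and `2` of `prob` over parts greater than one. -/
theorem hess_mul_precision (hρ : 0 < ρ) (hroot : (h d).eval ρ = 0) :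
    hess d ρ * precision d ρ = 1 := by
  have hμ := mean_pos (prob_pos (d := d) hρ)
  set μ := mean (prob d ρ) with hμdef
  set E := secondMoment d ρ with hE
  ext k l
  rw [Matrix.mul_apply, Matrix.one_apply]
  have hterm : ∀ j : Fin d, hess d ρ k j * precision d ρ j l =
      (if j = l then ρ ^ ((k : ℕ) + 2) * μ * (E / μ ^ 3 - (k + l + 4) / μ ^ 2) else 0) +
      (if j = k then (if k = l then 1 else 0) +
        ρ ^ ((k : ℕ) + 2) * ((k + 2) * (l + 2) / ρ - (k + 1) * (l + 1)) else 0) +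
      ρ ^ ((k : ℕ) + 2) * μ * (
        (E / μ ^ 3 - (k + 2) / μ ^ 2) * (l + 1) * ρ ^ ((j : ℕ) + 2) +
        ((E / μ ^ 3 - (k + 2) / μ ^ 2) * ((l + 2) / ρ - (l + 1)) - (l + 1) / μ ^ 2) *
          ((j + 2) * ρ ^ ((j : ℕ) + 2)) -
        ((l + 2) / ρ - (l + 1)) / μ ^ 2 * ((j + 2) ^ 2 * ρ ^ ((j : ℕ) + 2))) := by
    intro j
    rw [hess_apply hρ, precision, Matrix.of_apply, ← hμdef, ← hE]
    by_cases hjk : j = k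
    · subst hjk
      by_cases hjl : j = l
      · subst hjl
        simp only [if_true]
        field_simp
        ring
      · simp only [if_true, if_neg hjl]
        field_simp
        ring
    · by_cases hjl : j = l
      · subst hjl
        simp only [if_true, if_neg hjk, if_neg (Ne.symm hjk)]
        field_simp
        ring
      · simp only [if_neg hjl, if_neg hjk, if_neg (Ne.symm hjk)]
        field_simp
        ring
  rw [Finset.sum_congr rfl fun j _ => hterm j, Finset.sum_add_distrib, Finset.sum_add_distrib,
    Finset.sum_ite_eq', Finset.sum_ite_eq', if_pos (Finset.mem_univ _), if_pos (Finset.mem_univ _),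
    ← Finset.mul_sum, Finset.sum_sub_distrib, Finset.sum_add_distrib, ← Finset.mul_sum,
    ← Finset.mul_sum, ← Finset.mul_sum, sum_tail_prob hroot, sum_tail_mean, sum_tail_secondMoment,
    ← hμdef, ← hE]
  field_simp
  ring

theorem det_hess_ne_zero (hρ : 0 < ρ) (hroot : (h d).eval ρ = 0) : (hess d ρ).det ≠ 0 :=
  (Matrix.isUnit_det_of_right_inverse (hess_mul_precision hρ hroot)).ne_zero

theorem inv_hess (hρ : 0 < ρ) (hroot : (h d).eval ρ = 0) : (hess d ρ)⁻¹ = precision d ρ :=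
  Matrix.inv_eq_right_inv (hess_mul_precision hρ hroot)

/-! ### The quadratic form -/

/-- The deviations of all multiplicities, given those of the parts greater than one. -/
noncomputable def fullDeviation (x : Fin d → ℝ) : Fin (d + 1) → ℝ :=
  Fin.cons (-∑ k : Fin d, ((k : ℝ) + 2) * x k) x

/-- Pearson's quadratic form at the deviations `x`. -/
noncomputable def quad (ρ : ℝ) (x : Fin d → ℝ) : ℝ :=
  ∑ i, (fullDeviation x i - prob d ρ i * ∑ j, fullDeviation x j) ^ 2 / prob d ρ i

theorem quad_nonneg (hρ : 0 < ρ) (x : Fin d → ℝ) : 0 ≤ quad ρ x :=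
  Finset.sum_nonneg fun i _ => div_nonneg (sq_nonneg _) (prob_pos hρ i).le

theorem quad_eq (hρ : 0 < ρ) (hroot : (h d).eval ρ = 0) (x : Fin d → ℝ) :
    quad ρ x = ∑ i, fullDeviation x i ^ 2 / prob d ρ i - (∑ j, fullDeviation x j) ^ 2 := by
  set y := ∑ j, fullDeviation x j with hy
  have hterm : ∀ i, (fullDeviation x i - prob d ρ i * y) ^ 2 / prob d ρ i =
      fullDeviation x i ^ 2 / prob d ρ i - 2 * y * fullDeviation x i + y ^ 2 * prob d ρ i := by
    intro i
    have := prob_pos (d := d) hρ i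
    field_simp
    ring
  rw [quad, ← hy, Finset.sum_congr rfl fun i _ => hterm i, Finset.sum_add_distrib,
    Finset.sum_sub_distrib, ← Finset.mul_sum, ← Finset.mul_sum, sum_prob hroot, ← hy]
  ring

/-- The two rank-one terms of `precision` are the square of the deviation of the number of ones,
over `ρ`, and minus the square of the total deviation. -/
theorem dotProduct_inv_hess (hρ : 0 < ρ) (hroot : (h d).eval ρ = 0) (x : Fin d → ℝ) :
    x ⬝ᵥ (hess d ρ)⁻¹.mulVec x = mean (prob d ρ) * quad ρ x := by
  rw [inv_hess hρ hroot, quad_eq hρ hroot, Fin.sum_univ_succ, Fin.sum_univ_succ]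
  simp only [fullDeviation, Fin.cons_zero, Fin.cons_succ, prob, Fin.val_zero, Fin.val_succ, zero_add,
    pow_one]
  have hy : -∑ k : Fin d, ((k : ℝ) + 2) * x k + ∑ k, x k = -∑ k : Fin d, ((k : ℝ) + 1) * x k := by
    rw [← Finset.sum_neg_distrib, ← Finset.sum_neg_distrib, ← Finset.sum_add_distrib]
    exact Finset.sum_congr rfl fun k _ => by ring
  rw [hy, neg_sq, neg_sq, sq (∑ k : Fin d, ((k : ℝ) + 2) * x k), sq (∑ k : Fin d, ((k : ℝ) + 1) * x k)]
  have hterm : ∀ k : Fin d, x k * (precision d ρ).mulVec x k = mean (prob d ρ) *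
      (((k + 2) * x k) * (∑ k : Fin d, ((k : ℝ) + 2) * x k) / ρ + x k ^ 2 / ρ ^ ((k : ℕ) + 1 + 1) -
        ((k + 1) * x k) * ∑ k : Fin d, ((k : ℝ) + 1) * x k) := by
    intro k
    have hrow : ∀ l : Fin d, precision d ρ k l * x l = mean (prob d ρ) *
        ((if k = l then x l / ρ ^ ((l : ℕ) + 2) else 0) + (k + 2) / ρ * ((l + 2) * x l) -
          (k + 1) * ((l + 1) * x l)) := by
      intro l
      rw [precision, Matrix.of_apply]
      split_ifs with h
      · subst h; ring
      · ring
    rw [Matrix.mulVec, dotProduct, Finset.sum_congr rfl fun l _ => hrow l, ← Finset.mul_sum,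
      Finset.sum_sub_distrib, Finset.sum_add_distrib, Finset.sum_ite_eq, if_pos (Finset.mem_univ _),
      ← Finset.mul_sum, ← Finset.mul_sum]
    ring
  rw [dotProduct, Finset.sum_congr rfl fun k _ => hterm k, ← Finset.mul_sum, Finset.sum_sub_distrib,
    Finset.sum_add_distrib, ← Finset.sum_div, ← Finset.sum_mul, ← Finset.sum_mul]

theorem sum_mul_fullDeviation (x : Fin d → ℝ) :
    ∑ i : Fin (d + 1), ((i : ℝ) + 1) * fullDeviation x i = 0 := by
  rw [Fin.sum_univ_succ]
  simp only [fullDeviation, Fin.cons_zero, Fin.cons_succ, Fin.val_zero, Fin.val_succ]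
  push_cast
  rw [zero_add, one_mul, neg_add_eq_zero]
  exact Finset.sum_congr rfl fun k _ => by ring

theorem abs_sub_le_sqrt_quad (hρ : 0 < ρ) (hroot : (h d).eval ρ = 0) (x : Fin d → ℝ)
    (i : Fin (d + 1)) :
    |fullDeviation x i - prob d ρ i * ∑ j, fullDeviation x j| ≤ √(quad ρ x) := by
  have hpi := prob_pos (d := d) hρ i
  have hp1 : prob d ρ i ≤ 1 := sum_prob hroot ▸
    Finset.single_le_sum (fun i _ => (prob_pos (d := d) hρ i).le) (Finset.mem_univ i)
  refine Real.abs_le_sqrt (le_trans ?_ (Finset.single_le_sum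
    (f := fun i => (fullDeviation x i - prob d ρ i * ∑ j, fullDeviation x j) ^ 2 / prob d ρ i)
    (fun i _ => div_nonneg (sq_nonneg _) (prob_pos hρ i).le) (Finset.mem_univ i)))
  exact le_div_self (sq_nonneg _) hpi hp1

/-- `quad` sees deviations only modulo multiples of `prob`. The constraint `∑ (i + 1) y i = 0`
recovers the missing multiple, because `prob` has positive mean. -/
theorem abs_fullDeviation_zero_le (hρ : 0 < ρ) (hroot : (h d).eval ρ = 0) (x : Fin d → ℝ) :
    |fullDeviation x 0| ≤
      (1 + (∑ i : Fin (d + 1), ((i : ℝ) + 1)) / mean (prob d ρ)) * √(quad ρ x) := by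
  have hμ := mean_pos (prob_pos (d := d) hρ)
  set y := ∑ j, fullDeviation x j with hy
  have h0 := abs_sub_le_sqrt_quad hρ hroot x 0
  have hp1 : prob d ρ 0 ≤ 1 := sum_prob hroot ▸
    Finset.single_le_sum (fun i _ => (prob_pos (d := d) hρ i).le) (Finset.mem_univ 0)
  have hyμ : mean (prob d ρ) * y =
      -∑ i : Fin (d + 1), ((i : ℝ) + 1) * (fullDeviation x i - prob d ρ i * y) := by
    simp only [mul_sub, Finset.sum_sub_distrib, sum_mul_fullDeviation, ← mul_assoc]
    rw [← Finset.sum_mul, mean]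
    ring
  have hyb : mean (prob d ρ) * |y| ≤ (∑ i : Fin (d + 1), ((i : ℝ) + 1)) * √(quad ρ x) := by
    rw [show mean (prob d ρ) * |y| = |mean (prob d ρ) * y| by rw [abs_mul, abs_of_pos hμ], hyμ, abs_neg, Finset.sum_mul]
    refine (Finset.abs_sum_le_sum_abs _ _).trans (Finset.sum_le_sum fun i _ => ?_)
    rw [abs_mul, abs_of_nonneg (by positivity : (0 : ℝ) ≤ (i : ℝ) + 1)]
    gcongr
    exact abs_sub_le_sqrt_quad hρ hroot x i
  have hyb' : |y| ≤ (∑ i : Fin (d + 1), ((i : ℝ) + 1)) / mean (prob d ρ) * √(quad ρ x) := by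
    rw [div_mul_eq_mul_div, le_div_iff₀ hμ, mul_comm]
    exact hyb
  calc |fullDeviation x 0| = |(fullDeviation x 0 - prob d ρ 0 * y) + prob d ρ 0 * y| := by
        rw [sub_add_cancel]
    _ ≤ √(quad ρ x) + 1 * |y| := by
        refine (abs_add_le _ _).trans (add_le_add h0 ?_)
        rw [abs_mul, abs_of_pos (prob_pos hρ 0)]
        gcongr
    _ ≤ _ := by linarith

/-! ### The constant in `A` -/

theorem peak_pos {p : Fin (d + 1) → ℝ} (hp : ∀ i, 0 < p i) : 0 < peak p := by
  have h2 : 0 < √(2 * Real.pi) := Real.sqrt_pos.2 (by positivity)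
  exact div_pos h2 (Finset.prod_pos fun i _ => mul_pos h2 (Real.sqrt_pos.2 (hp i)))

/-- The limit of `√n ^ d * ρ ^ n * A d ρ n`. -/
noncomputable def scale (d : ℕ) (ρ : ℝ) : ℝ := peak (prob d ρ) * √(mean (prob d ρ)) ^ d

theorem scale_pos (hρ : 0 < ρ) : 0 < scale d ρ :=
  mul_pos (peak_pos (prob_pos hρ)) (pow_pos (Real.sqrt_pos.2 (mean_pos (prob_pos hρ))) d)

theorem prod_prob : ∏ i, prob d ρ i = ρ ^ (d * (d + 1) / 2) * ρ ^ (d + 1) := by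
  simp only [prob]
  rw [Finset.prod_pow_eq_pow_sum, ← pow_add, Finset.sum_add_distrib]
  congr 2
  · rw [← Finset.sum_range (fun i => i), Finset.sum_range_id, Nat.add_sub_cancel, mul_comm]
  · simp

/-- At the root, the two sums under the square root in `A` are `μ / ρ` and `1 / ρ`. -/
theorem A_eq (hρ : 0 < ρ) (hroot : (h d).eval ρ = 0) {n : ℕ} (hn : n ≠ 0) :
    A d ρ n = scale d ρ / (ρ ^ n * √(n : ℝ) ^ d) := by
  have hμ := mean_pos (prob_pos (d := d) hρ)
  set μ := mean (prob d ρ) with hμdef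
  have hn0 : (0 : ℝ) < n := by positivity
  have hsn := Real.sqrt_pos.2 hn0
  have hpi2 : 0 < √(2 * Real.pi) := Real.sqrt_pos.2 (by positivity)
  have hsμ := Real.sqrt_pos.2 hμ
  set Q := ρ ^ (d * (d + 1) / 2) with hQ
  have hQpos : 0 < Q := pow_pos hρ _
  have hS1 : ∑ i ∈ Finset.range (d + 1), ((i : ℝ) + 1) * ρ ^ i = μ / ρ := by
    rw [eq_div_iff hρ.ne', Finset.sum_mul, Finset.sum_range, hμdef, mean]
    exact Finset.sum_congr rfl fun i _ => by rw [prob]; ring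
  have hS0 : ∑ i ∈ Finset.range (d + 1), ρ ^ i = 1 / ρ := by
    rw [eq_div_iff hρ.ne', Finset.sum_mul, Finset.sum_range, ← sum_prob hroot]
    exact Finset.sum_congr rfl fun i _ => by rw [prob]; ring
  have hsqrt : √((μ / ρ) ^ (d + 2) / (1 / ρ * Q)) = μ * √μ ^ d / √(Q * ρ ^ (d + 1)) := by
    have : (μ / ρ) ^ (d + 2) / (1 / ρ * Q) = (μ * √μ ^ d) ^ 2 / (Q * ρ ^ (d + 1)) := by
      rw [mul_pow, ← pow_mul, mul_comm d 2, pow_mul, Real.sq_sqrt hμ.le, div_pow]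
      field_simp
      ring
    rw [this, Real.sqrt_div (by positivity), Real.sqrt_sq (by positivity)]
  have hpeak : peak (prob d ρ) = 1 / (√(2 * Real.pi) ^ d * √(Q * ρ ^ (d + 1))) := by
    have hprod : ∏ i, √(prob d ρ i) = √(Q * ρ ^ (d + 1)) := by
      rw [← prod_prob, Real.sqrt_prod _ fun i _ => (prob_pos hρ i).le]
    rw [peak, Finset.prod_mul_distrib, hprod, Finset.prod_const, Finset.card_univ, Fintype.card_fin,
      pow_succ]
    have : 0 < √(Q * ρ ^ (d + 1)) := Real.sqrt_pos.2 (by positivity)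
    field_simp
  have hpow : (n : ℝ) ^ (-(d : ℝ) / 2) = (√(n : ℝ) ^ d)⁻¹ := by
    rw [neg_div, Real.rpow_neg hn0.le, Real.rpow_div_two_eq_sqrt _ hn0.le, Real.rpow_natCast]
  have hpow2 : (2 * Real.pi) ^ ((d : ℝ) / 2) = √(2 * Real.pi) ^ d := by
    rw [Real.rpow_div_two_eq_sqrt _ (by positivity), Real.rpow_natCast]
  rw [A, hS1, hS0, hsqrt, hpow, hpow2, neg_mul, mul_h1, neg_neg, scale, hpeak, ← hμdef]
  have : 0 < √(Q * ρ ^ (d + 1)) := Real.sqrt_pos.2 (by positivity)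
  field_simp

theorem A_pos (hρ : 0 < ρ) (hroot : (h d).eval ρ = 0) {n : ℕ} (hn : n ≠ 0) : 0 < A d ρ n := by
  rw [A_eq hρ hroot hn]
  have : 0 < √(n : ℝ) := Real.sqrt_pos.2 (by positivity)
  have := scale_pos (d := d) hρ
  positivity

theorem mass_prob (a : Fin (d + 1) → ℕ) :
    mass (prob d ρ) a = Nat.multinomial Finset.univ a * ρ ^ weight a := by
  rw [mass, weight, ← Finset.prod_pow_eq_pow_sum]
  congr 1
  exact Finset.prod_congr rfl fun i _ => by rw [prob, pow_mul]

theorem weight_multiplicities {n : ℕ} {s : Fin d → ℕ} (hs : tailWeight s ≤ n) :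
    weight (multiplicities n s) = n := by
  rw [weight, Fin.sum_univ_succ]
  simp only [multiplicities, Fin.cons_zero, Fin.cons_succ, Fin.val_zero, Fin.val_succ, zero_add,
    one_mul]
  rw [tailWeight] at hs ⊢
  exact Nat.sub_add_cancel hs

/-! ### The Gaussian in terms of Pearson's statistic -/

theorem m_apply (hρ : 0 < ρ) (k : Fin d) : m d ρ k = ρ ^ ((k : ℕ) + 2) / mean (prob d ρ) := by
  have hμ := mean_pos (prob_pos (d := d) hρ)
  rw [m, h1_eq hρ]
  field_simp
  ring

theorem v_eq_exp_quad (hρ : 0 < ρ) (hroot : (h d).eval ρ = 0) (n : ℕ) (s : Fin d → ℝ) :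
    v d ρ n s = Real.exp (-(mean (prob d ρ) * quad ρ (s - (n : ℝ) • m d ρ) / (2 * n))) := by
  rw [v, dotProduct_inv_hess hρ hroot, neg_div]

theorem v_le_one (hρ : 0 < ρ) (hroot : (h d).eval ρ = 0) (n : ℕ) (s : Fin d → ℝ) :
    v d ρ n s ≤ 1 := by
  rw [v_eq_exp_quad hρ hroot, Real.exp_le_one_iff, neg_nonpos]
  have := mean_pos (prob_pos (d := d) hρ)
  have := quad_nonneg hρ (s - (n : ℝ) • m d ρ)
  positivity

theorem fullDeviation_zero (hρ : 0 < ρ) (n : ℕ) (s : Fin d → ℕ) :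
    fullDeviation ((fun i => (s i : ℝ)) - (n : ℝ) • m d ρ) 0 =
      n - tailWeight s - n * ρ / mean (prob d ρ) := by
  have hμ := mean_pos (prob_pos (d := d) hρ)
  have hterm : ∀ k : Fin d, ((k : ℝ) + 2) * ((fun i => (s i : ℝ)) - (n : ℝ) • m d ρ) k =
      (k + 2) * s k - n / mean (prob d ρ) * ((k + 2) * ρ ^ ((k : ℕ) + 2)) := by
    intro k
    simp only [Pi.sub_apply, Pi.smul_apply, smul_eq_mul, m_apply hρ]
    ring
  rw [fullDeviation, Fin.cons_zero, Finset.sum_congr rfl fun k _ => hterm k,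
    Finset.sum_sub_distrib, ← Finset.mul_sum, sum_tail_mean, tailWeight]
  push_cast
  field_simp
  ring

theorem fullDeviation_eq (hρ : 0 < ρ) {n : ℕ} {s : Fin d → ℕ} (hs : tailWeight s ≤ n)
    (i : Fin (d + 1)) :
    fullDeviation ((fun i => (s i : ℝ)) - (n : ℝ) • m d ρ) i =
      multiplicities n s i - n / mean (prob d ρ) * prob d ρ i := by
  refine Fin.cases ?_ (fun k => ?_) i
  · rw [fullDeviation_zero hρ, multiplicities, Fin.cons_zero, Nat.cast_sub hs, prob]
    simp only [Fin.val_zero]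
    ring
  · simp only [fullDeviation, Fin.cons_succ, multiplicities, Pi.sub_apply, Pi.smul_apply,
      smul_eq_mul, m_apply hρ, prob, Fin.val_succ]
    ring

/-- Centring at `(n / μ) p` or at `N p` gives the same value, as `quad` removes multiples of `p`. -/
theorem quad_eq_pearson (hρ : 0 < ρ) (hroot : (h d).eval ρ = 0) {n : ℕ} {s : Fin d → ℕ}
    (hs : tailWeight s ≤ n) (hN : trials (multiplicities n s) ≠ 0) :
    quad ρ ((fun i => (s i : ℝ)) - (n : ℝ) • m d ρ) =
      2 * trials (multiplicities n s) * pearson (prob d ρ) (multiplicities n s) := by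
  have hN0 : (0 : ℝ) < trials (multiplicities n s) := by positivity
  have hsum : ∑ i, fullDeviation ((fun i => (s i : ℝ)) - (n : ℝ) • m d ρ) i =
      trials (multiplicities n s) - n / mean (prob d ρ) := by
    simp only [fullDeviation_eq hρ hs]
    rw [Finset.sum_sub_distrib, ← Finset.mul_sum, sum_prob hroot, trials]
    push_cast
    ring
  rw [quad, hsum, pearson, Finset.mul_sum]
  refine Finset.sum_congr rfl fun i _ => ?_
  have := prob_pos hρ i
  rw [fullDeviation_eq hρ hs, ratio]
  field_simp
  ring

theorem v_eq_exp_pearson (hρ : 0 < ρ) (hroot : (h d).eval ρ = 0) {n : ℕ} {s : Fin d → ℕ}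
    (hs : tailWeight s ≤ n) (hN : trials (multiplicities n s) ≠ 0) :
    v d ρ n (fun i => (s i : ℝ)) = Real.exp (-(mean (prob d ρ) * trials (multiplicities n s) / n *
      pearson (prob d ρ) (multiplicities n s))) := by
  rw [v_eq_exp_quad hρ hroot, quad_eq_pearson hρ hroot hs hN]
  congr 2
  rcases eq_or_ne n 0 with rfl | hn
  · simp
  · have : (0 : ℝ) < n := by positivity
    field_simp

/-- The Gaussian is uniformly small where the coefficients vanish for reasons of size. -/
theorem eventually_v_le_of_lt (hρ : 0 < ρ) (hroot : (h d).eval ρ = 0) {ε : ℝ} (hε : 0 < ε) :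
    ∀ᶠ n : ℕ in atTop, ∀ s : Fin d → ℕ, n < tailWeight s → v d ρ n (fun i => (s i : ℝ)) ≤ ε := by
  have hμ := mean_pos (prob_pos (d := d) hρ)
  set μ := mean (prob d ρ) with hμdef
  set C := 1 + (∑ i : Fin (d + 1), ((i : ℝ) + 1)) / μ with hC
  have hCpos : 0 < C := by positivity
  -- Beyond the range the number of ones deviates by at least `n ρ / μ`, so `quad ≥ (n ρ / (μ C)) ^
  -- 2` and the exponent `μ * quad / (2 n)` is at least `κ n`.
  set κ := ρ ^ 2 / (2 * μ * C ^ 2) with hκ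
  have hκpos : 0 < κ := by positivity
  have hlim : Tendsto (fun n : ℕ => Real.exp (-(κ * n))) atTop (𝓝 0) :=
    Real.tendsto_exp_neg_atTop_nhds_zero.comp
      (tendsto_natCast_atTop_atTop.const_mul_atTop hκpos)
  filter_upwards [hlim.eventually_le_const hε, eventually_ne_atTop 0] with n hn hn0 s hs
  refine le_trans ?_ hn
  have hnpos : (0 : ℝ) < n := by positivity
  rw [v_eq_exp_quad hρ hroot, Real.exp_le_exp, neg_le_neg_iff, ← hμdef]
  set q := quad ρ ((fun i => (s i : ℝ)) - (n : ℝ) • m d ρ) with hq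
  have h0 : 0 ≤ q := quad_nonneg hρ _
  have h1 := abs_fullDeviation_zero_le hρ hroot ((fun i => (s i : ℝ)) - (n : ℝ) • m d ρ)
  rw [fullDeviation_zero hρ, ← hμdef, ← hC, ← hq] at h1
  have hs' : (n : ℝ) < tailWeight s := by exact_mod_cast hs
  have h2 : n * ρ / μ ≤ C * √q := by
    refine le_trans ?_ h1
    rw [← abs_neg]
    exact le_trans (by linarith) (le_abs_self _)
  have h3 : (n * ρ / μ) ^ 2 ≤ C ^ 2 * q := by
    calc (n * ρ / μ) ^ 2 ≤ (C * √q) ^ 2 := by gcongr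
      _ = C ^ 2 * q := by rw [mul_pow, Real.sq_sqrt h0]
  rw [le_div_iff₀ (by positivity)]
  calc κ * n * (2 * n) = μ / C ^ 2 * (n * ρ / μ) ^ 2 := by rw [hκ]; field_simp
    _ ≤ μ / C ^ 2 * (C ^ 2 * q) := by gcongr
    _ = μ * q := by field_simp

/-! ### The local limit theorem -/

theorem eventually_abs_coeff_div_sub_le (hρ : 0 < ρ) (hroot : (h d).eval ρ = 0) {ε : ℝ}
    (hε : 0 < ε) :
    ∀ᶠ n : ℕ in atTop, ∀ s : Fin d →₀ ℕ,
      |(slice d n).coeff s / A d ρ n - v d ρ n (fun i => (s i : ℝ))| ≤ ε := by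
  have hc := scale_pos (d := d) hρ
  -- Along the comap of `atTop` under `trials`, the limit is uniform over all vectors with many
  -- trials. As `weight ≤ (d + 1) * trials`, taking `n ≥ (d + 1) * (N₀ + 1)` ensures this.
  have hlim := tendsto_sqrt_weight_pow_mul_mass_sub (prob_pos (d := d) hρ) (sum_prob hroot)
    (tendsto_comap (f := trials) (x := atTop))
  have hev := hlim.abs.eventually_le_const (u := scale d ρ * ε) (by simpa using mul_pos hc hε)
  obtain ⟨N₀, hN₀⟩ := eventually_atTop.1 (eventually_comap.1 hev)
  filter_upwards [eventually_v_le_of_lt hρ hroot hε, eventually_ge_atTop ((d + 1) * (N₀ + 1))]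
    with n hv hn s
  have hn0 : n ≠ 0 := by
    have := Nat.le_mul_of_pos_left (N₀ + 1) (Nat.succ_pos d)
    rw [Nat.succ_eq_add_one] at this
    omega
  rw [coeff_slice_eq_multinomial]
  split_ifs with hs
  · set a := multiplicities n s with ha
    have hw : weight a = n := weight_multiplicities hs
    have hN : N₀ + 1 ≤ trials a := by
      refine Nat.le_of_mul_le_mul_left (hn.trans ?_) (Nat.succ_pos d)
      rw [← hw]
      exact weight_le_mul_trials a
    have hNa : trials a ≠ 0 := by omega
    have h1 := hN₀ (trials a) (by omega) a rfl
    rw [hw, mass_prob, hw, ← scale] at h1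
    rw [v_eq_exp_pearson hρ hroot hs hNa, A_eq hρ hroot hn0, ← ha]
    have hsn : 0 < √(n : ℝ) := Real.sqrt_pos.2 (by positivity)
    refine le_of_mul_le_mul_left (le_trans (le_of_eq ?_) h1) hc
    rw [← abs_of_pos hc, ← abs_mul, abs_of_pos hc]
    congr 1
    field_simp
  · rw [zero_div, zero_sub, abs_neg, v, abs_of_pos (Real.exp_pos _)]
    exact hv s (not_le.1 hs)

/-- Rounding `n m` down moves each coordinate by at most one, so the quadratic form stays bounded
and is killed by `1 / n`. -/
theorem exists_tendsto_v_one (d : ℕ) (hρ : 0 < ρ) :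
    ∃ s : ℕ → Fin d →₀ ℕ, Tendsto (fun n => v d ρ n (fun i => (s n i : ℝ))) atTop (𝓝 1) := by
  have hμ := mean_pos (prob_pos (d := d) hρ)
  refine ⟨fun n => Finsupp.equivFunOnFinite.symm fun k => ⌊n * m d ρ k⌋₊, ?_⟩
  set x : ℕ → Fin d → ℝ := fun n => (fun k => (⌊n * m d ρ k⌋₊ : ℝ)) - (n : ℝ) • m d ρ with hx
  have hx1 : ∀ n k, |x n k| ≤ 1 := by
    intro n k
    have h0 : 0 ≤ n * m d ρ k := by rw [m_apply hρ]; positivity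
    have h1 := Nat.floor_le h0
    have h2 := Nat.lt_floor_add_one (n * m d ρ k)
    simp only [hx, Pi.sub_apply, Pi.smul_apply, smul_eq_mul]
    rw [abs_le]
    constructor <;> linarith
  set B := ∑ k, ∑ l, |(hess d ρ)⁻¹ k l| with hB
  have hquad : ∀ n, |x n ⬝ᵥ (hess d ρ)⁻¹.mulVec (x n)| ≤ B := by
    intro n
    refine (Finset.abs_sum_le_sum_abs _ _).trans (Finset.sum_le_sum fun k _ => ?_)
    rw [abs_mul]
    refine (mul_le_of_le_one_left (abs_nonneg _) (hx1 n k)).trans ?_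
    rw [Matrix.mulVec, dotProduct]
    refine (Finset.abs_sum_le_sum_abs _ _).trans (Finset.sum_le_sum fun l _ => ?_)
    rw [abs_mul]
    exact mul_le_of_le_one_right (abs_nonneg _) (hx1 n l)
  have hlim : Tendsto (fun n : ℕ => -(x n ⬝ᵥ (hess d ρ)⁻¹.mulVec (x n)) / (2 * n)) atTop (𝓝 0) := by
    have h0 : Tendsto (fun n : ℕ => B / (2 * n)) atTop (𝓝 0) :=
      (tendsto_natCast_atTop_atTop.const_mul_atTop zero_lt_two).const_div_atTop B
    refine squeeze_zero_norm (fun n => ?_) h0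
    rw [norm_div, norm_neg, Real.norm_eq_abs, Real.norm_of_nonneg (by positivity)]
    gcongr
    exact hquad n
  have := hlim.rexp
  rw [Real.exp_zero] at this
  exact this

/-- The bound `v ≤ 1` at a maximiser gives the upper estimate, the lattice points near `n m` the
lower one. -/
theorem tendsto_maxCoeff_div (hρ : 0 < ρ) (hroot : (h d).eval ρ = 0) :
    Tendsto (fun n : ℕ => maxCoeff (slice d n) / A d ρ n) atTop (𝓝 1) := by
  obtain ⟨s, hs⟩ := exists_tendsto_v_one d hρ
  rw [Metric.tendsto_nhds]
  intro ε hε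
  filter_upwards [eventually_abs_coeff_div_sub_le hρ hroot (show 0 < ε / 3 by positivity),
    Metric.tendsto_nhds.1 hs (ε / 3) (by positivity), eventually_ne_atTop 0] with n h1 h2 hn
  have hA := A_pos hρ hroot hn
  obtain ⟨⟨s₀, hs₀⟩, hmax⟩ := isGreatest_maxCoeff (slice d n)
  have hs₀' : (slice d n).coeff s₀ = maxCoeff (slice d n) := hs₀
  have hle : (slice d n).coeff (s n) / A d ρ n ≤ maxCoeff (slice d n) / A d ρ n := by
    gcongr
    exact hmax ⟨s n, rfl⟩
  have h3 := abs_le.1 (h1 s₀)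
  have h4 := abs_le.1 (h1 (s n))
  have h5 := v_le_one hρ hroot n (fun i => (s₀ i : ℝ))
  rw [Real.dist_eq] at h2 ⊢
  have h6 := abs_lt.1 h2
  rw [hs₀'] at h3
  rw [abs_lt]
  constructor <;> linarith

end BandedPerm

theorem theorem4p2 (d : ℕ) :
    (∀ (n : ℕ) (s : Fin d →₀ ℕ),
      (BandedPerm.slice d n).coeff s = (BandedPerm.permCount d n s : ℝ)) ∧
    ∃ ρ : ℝ, IsLeast {t : ℝ | 0 < t ∧ (BandedPerm.h d).eval t = 0} ρ ∧
      (BandedPerm.hess d ρ).det ≠ 0 ∧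
      (fun n : ℕ => BandedPerm.maxCoeff (BandedPerm.slice d n)) ~[atTop] BandedPerm.A d ρ ∧
      Tendsto
        (fun n : ℕ => ⨆ s : Fin d →₀ ℕ,
          ENNReal.ofReal |(BandedPerm.slice d n).coeff s / BandedPerm.A d ρ n -
            BandedPerm.v d ρ n (fun i => (s i : ℝ))|)
        atTop (𝓝 0) := by
  refine ⟨BandedPerm.coeff_slice_eq_permCount d, ?_⟩
  obtain ⟨ρ, hleast⟩ := BandedPerm.exists_isLeast_root d
  obtain ⟨hρ, hroot⟩ := hleast.1
  refine ⟨ρ, hleast, BandedPerm.det_hess_ne_zero hρ hroot,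
    isEquivalent_of_tendsto_one (BandedPerm.tendsto_maxCoeff_div hρ hroot), ?_⟩
  rw [ENNReal.tendsto_nhds_zero]
  intro ε hε
  -- The value `⊤` is split off because its `toReal` is `0`.
  rcases eq_or_ne ε ⊤ with rfl | htop
  · exact Eventually.of_forall fun n => le_top
  · filter_upwards [BandedPerm.eventually_abs_coeff_div_sub_le hρ hroot
      (ENNReal.toReal_pos hε.ne' htop)] with n hn
    exact iSup_le fun s => ENNReal.ofReal_le_of_le_toReal (hn s)
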